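/- A folded ribbon knot of width $w>0$ is obtained from an oriented closed polygon (knot diagram) in the plane by placing at every vertex, with fold angle $\theta_i\in[0,\pi)$, a fold line of length $w/\cos(\theta_i/2)$ centred at the vertex and perpendicular to the bisector of the fold angle, by joining the ends of consecutive fold lines, which have to be disjoint, to straight pieces of ribbon of width $w$, and by choosing consistent over- and under-information for overlapping pieces (wherever pieces overlap they are stacked, no piece passes through a fold, and no two folds pass through each other). A fold is an overfold (underfold) if the outgoing piece lies over (under) the incoming one. The folded ribbonlength is the length of the polygon divided by $w$. The ribbon linking number is the linking number (half of the sum of the crossing signs) of the knot with one boundary component of the ribbon, oriented in parallel. **Construction.** Let $w=1$, $\theta\in(0,\pi)$, $d>0$, $m\ge 1$, $n\ge 0$. Make a zigzag with vertices $v_S=p_0,p_1,\dots,p_{2m+2n}$, all with fold angle $\theta$ and at consecutive distances $d$, with left turns at $p_i$ for even $i$ and right turns for odd $i$. The $2m$ folds at $p_0,\dots,p_{2m-1}$ are overfolds and form an escape accordion: the parallel pieces of ribbon entering it and leaving it are at distance at least $1$, that is, $2md\sin(\theta/2)\cos(\theta/2)\ge 1$. The vertices $v_E=p_{2m}=w_1,\dots,p_{2m+2n}=w_{2n+1}$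 carry $2n+1$ half-wraps: alternately a left underfold, which takes the ribbon below everything made so far, and a right overfold, which takes it above everything made so far. The ribbon leaving $w_{2n+1}$ and the ribbon entering $v_S$ are then folded at points $E$ and $A$, where the line $AE$ is parallel to the line $v_Sw_{2n+1}$ and at some distance $h>0$ from it on the side of the zigzag, and joined behind everything, with a left underfold at $E$ and a left overfold at $A$. **Theorem.** 1. For every odd integer $k$ and every $\varepsilon>0$ there is a folded ribbon knot that is a topological Möbius band, is an unknot, has ribbon linking number $k$ and has folded ribbonlength exactly $3\sqrt3+\varepsilon$, such that it is given by the Construction with fold angle $\theta=\pi/3$ and $2n+1=|k|$ half-wraps if $k>0$, and is the mirror image (over and under interchanged) of one given so if $k<0$. All its fold angles, including those at $A$ and $E$, are equal to $\pi/3$. 2. The angle $\pi/3$ minimises the folded ribbonlength of the Construction: for all $\theta\in(0,\pi)$ and $n\ge 0$ the infimum of the folded ribbonlengths of the folded ribbon knots that the Construction gives with fold angle $\theta$ and $2n+1$ half-wraps is $$F(\theta)=\frac{2}{\cos(\theta/2)}+\frac{1}{\cos(\theta/2)\sin(\theta/2)}+\tan(\theta/2),$$ $F(\pi/3)=3\sqrt3$,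 and $F(\theta)>F(\pi/3)$ for all $\theta\in(0,\pi)$ with $\theta\neq\pi/3$. -/

import Mathlib

/-!
Folded ribbon knots in the plane `ℂ`, their folded ribbonlength, knot type and ribbon linking
number, and the multi-twist folded ribbon Möbius band made of an escape accordion followed by
half-wraps.
-/

noncomputable section

/-! ### Polygonal knots in three-space up to triangle moves -/

section PolygonalKnots

variable {V : Type*} [AddCommGroup V] [Module ℝ V]

/-- The polygonal path through the points of a list. -/
def polyline : List V → Set V
  | [] => ∅
  | [a] => {a}
  | a :: b :: l => segment ℝ a b ∪ polyline (b :: l)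

/-- The polygonal path through the points of a list is simple (has no self-intersections). -/
def IsSimpleArc : List V → Prop
  | [] => False
  | [_] => True
  | a :: b :: l => a ≠ b ∧ segment ℝ a b ∩ polyline (b :: l) = {b} ∧ IsSimpleArc (b :: l)

/-- The closed polygon with the listed vertices (the last one is joined to the first one) is
simple. -/
def IsSimpleClosedPolygon : List V → Prop
  | [] => False
  | [_] => False
  | a :: b :: l =>
      segment ℝ a b ∩ polyline (b :: (l ++ [a])) = {a, b} ∧ IsSimpleArc (b :: (l ++ [a]))

/-- Elementary moves of polygonal knots: a change of the starting vertex, and the triangle move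
replacing the edge `ab` by the two edges `ac`, `cb`, when the solid triangle `acb` meets the rest of
the polygon in `a` and `b` only (a point `c` of the edge `ab` gives a subdivision). -/
inductive TriangleMove : List V → List V → Prop
  | rotate (a : V) (l : List V) : TriangleMove (a :: l) (l ++ [a])
  | triangle (a b c : V) (l : List V)
      (before : IsSimpleClosedPolygon (a :: b :: l))
      (after : IsSimpleClosedPolygon (a :: c :: b :: l))
      (empty : convexHull ℝ {a, c, b} ∩ polyline (b :: (l ++ [a])) = {a, b}) :
      TriangleMove (a :: b :: l) (a :: c :: b :: l)

/-- A polygonal knot is an unknot if finitely many triangle moves and inverse triangle moves turn it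
into a triangle. -/
def IsPolygonalUnknot (l : List V) : Prop :=
  IsSimpleClosedPolygon l ∧
    ∃ a b c : V, IsSimpleClosedPolygon [a, b, c] ∧ Relation.EqvGen TriangleMove l [a, b, c]

end PolygonalKnots

/-! ### Folded ribbon knots -/

/-- The planar cross product: positive iff `w` points to the left of `z`. -/
def planeCross (z w : ℂ) : ℝ := (starRingEnd ℂ z * w).im

/-- The data of a folded ribbon: the vertices of an oriented closed polygon in the plane (indices
are cyclic), the width of the ribbon, and the over- and under-information. Edge `i` runs from vertex
`i` to vertex `i + 1`; `isOver i j` says that the straight piece of ribbon along edge `i` lies over the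
one along edge `j` (it carries information only where these pieces overlap). -/
structure RibbonDiagram (N : ℕ) [NeZero N] where
  vertex : Fin N → ℂ
  width : ℝ
  isOver : Fin N → Fin N → Prop

namespace RibbonDiagram

variable {N : ℕ} [NeZero N] (D : RibbonDiagram N)

/-- The length of the polygon. -/
def length : ℝ := ∑ i, ‖D.vertex (i + 1) - D.vertex i‖

/-- The folded ribbonlength: length of the knot over width of the ribbon. -/
def ribbonlength : ℝ := D.length / D.width

/-- The fold angle at a vertex, in `[0, π]`. -/
def foldAngle (i : Fin N) : ℝ :=
  InnerProductGeometry.angle (D.vertex (i - 1) - D.vertex i) (D.vertex (i + 1) - D.vertex i)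

/-- The unit direction of edge `i`. -/
def dir (i : Fin N) : ℂ :=
  ((‖D.vertex (i + 1) - D.vertex i‖⁻¹ : ℝ) : ℂ) * (D.vertex (i + 1) - D.vertex i)

/-- Half of the fold line at vertex `i`, as a vector. The bisector of the fold angle `θ` has direction
`dir i - dir (i - 1)`, a vector of length `2 cos (θ / 2)`; so this vector is perpendicular to the
bisector and has length `width / (2 cos (θ / 2))`. It points to the left of edge `i` and to the right
of edge `i - 1`, and its ends are at distance `width / 2` from the lines through both edges. -/
def foldVec (i : Fin N) : ℂ :=
  ((D.width / ‖D.dir i - D.dir (i - 1)‖ ^ 2 : ℝ) : ℂ) * (Complex.I * (D.dir i - D.dir (i - 1)))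

/-- The fold line at vertex `i`. -/
def foldLine (i : Fin N) : Set ℂ :=
  segment ℝ (D.vertex i - D.foldVec i) (D.vertex i + D.foldVec i)

/-- The straight piece of ribbon along edge `i`, between the fold lines at its two ends. -/
def face (i : Fin N) : Set ℂ :=
  convexHull ℝ {D.vertex i - D.foldVec i, D.vertex i + D.foldVec i,
    D.vertex (i + 1) - D.foldVec (i + 1), D.vertex (i + 1) + D.foldVec (i + 1)}

/-- Two straight pieces of ribbon overlap. -/
def Overlap (i j : Fin N) : Prop := (interior (D.face i) ∩ interior (D.face j)).Nonempty

/-- Layer `k` lies between the layers `i` and `j`. -/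
def Between (i j k : Fin N) : Prop := (D.isOver i k ∧ D.isOver k j) ∨ (D.isOver j k ∧ D.isOver k i)

/-- The diagram is a folded ribbon knot. Vertices of fold angle `π`, where nothing is folded, do not
count as vertices. -/
structure IsFoldedRibbonKnot : Prop where
  width_pos : 0 < D.width
  vertex_ne : ∀ i, D.vertex (i + 1) ≠ D.vertex i
  dir_ne : ∀ i, D.dir i ≠ D.dir (i - 1)
  /-- The ribbon is immersed away from the fold lines: the fold lines are disjoint. -/
  foldLine_disjoint : ∀ i, Disjoint (D.foldLine i) (D.foldLine (i + 1))
  /-- Of two overlapping pieces of ribbon, exactly one lies over the other. -/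
  over_xor : ∀ i j, i ≠ j → D.Overlap i j → Xor (D.isOver i j) (D.isOver j i)
  /-- Wherever three pieces of ribbon overlap, they are stacked. -/
  over_trans : ∀ i j k,
    (interior (D.face i) ∩ interior (D.face j) ∩ interior (D.face k)).Nonempty →
      D.isOver i j → D.isOver j k → D.isOver i k
  /-- No piece of ribbon passes through a fold (the fold at vertex `i` joins the pieces `i - 1`
  and `i`). -/
  not_through_fold : ∀ i j, j ≠ i → j ≠ i - 1 →
    (interior (D.face j) ∩ D.foldLine i).Nonempty → ¬ D.Between (i - 1) i j
  /-- Two folds along overlapping fold lines, with the ribbon on the same side, do not pass through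
  each other: the layers joined by one of them are both between the layers joined by the other,
  or neither is. -/
  not_interleaved : ∀ i j, i ≠ j → (D.foldLine i ∩ D.foldLine j).Nontrivial → D.Overlap i j →
    (D.Between (i - 1) i (j - 1) ↔ D.Between (i - 1) i j)

/-! #### The boundary of the ribbon -/

/-- The sides of an edge: `true` is left, `false` is right. -/
def sideSign (b : Bool) : ℂ := if b then 1 else -1

/-- The starting point of the boundary strand on side `b` of edge `i`. -/
def strandStart (p : Fin N × Bool) : ℂ := D.vertex p.1 + sideSign p.2 * D.foldVec p.1

/-- The end of the boundary strand on side `b` of edge `i`. -/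
def strandEnd (p : Fin N × Bool) : ℂ :=
  D.vertex (p.1 + 1) - sideSign p.2 * D.foldVec (p.1 + 1)

/-- A fold is a reflection: a strand on one side of an edge is continued by the strand
on the other side of the next edge. -/
def nextStrand (N : ℕ) [NeZero N] : Equiv.Perm (Fin N × Bool) :=
  (Equiv.addRight (1 : Fin N)).prodCongr Equiv.boolNot

theorem strandStart_nextStrand (p : Fin N × Bool) :
    D.strandStart (nextStrand N p) = D.strandEnd p := by
  obtain ⟨i, b⟩ := p
  cases b <;> simp [strandStart, strandEnd, nextStrand, sideSign, sub_eq_add_neg]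

open Classical in
/-- The strands of the boundary component of the ribbon that starts on the left of edge `0`. -/
def boundaryComponent (N : ℕ) [NeZero N] : Finset (Fin N × Bool) :=
  Finset.univ.filter fun p => (nextStrand N).SameCycle (0, true) p

/-- The ribbon (a band whose ends have been joined) is a topological Möbius band: following the left
boundary of edge `0` one arrives on the right of edge `0`, so that the boundary is connected.
Otherwise the ribbon is an annulus. -/
def IsMobius (_D : RibbonDiagram N) : Prop := ((0, false) : Fin N × Bool) ∈ boundaryComponent N

open Classical in
/-- The sign of the crossing of edge `i` of the knot with the boundary strand `p`, and `0` if they do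
not meet. A crossing is positive iff the under strand crosses the over strand from right to left. -/
def crossingSign (i : Fin N) (p : Fin N × Bool) : ℤ :=
  if (segment ℝ (D.vertex i) (D.vertex (i + 1)) ∩
      segment ℝ (D.strandStart p) (D.strandEnd p)).Nonempty then
    (if D.isOver i p.1 then (SignType.sign (planeCross (D.dir i) (D.dir p.1)) : ℤ)
      else (SignType.sign (planeCross (D.dir p.1) (D.dir i)) : ℤ))
  else 0

/-- The ribbon linking number is `k`: the knot and one boundary component of the ribbon, oriented in
parallel, meet in the plane only in transverse crossings, away from the vertices of both of them, and
half of the sum of the signs of these crossings is `k`. -/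
def HasRibbonLinkingNumber (k : ℤ) : Prop :=
  (∀ i, ∀ p ∈ boundaryComponent N, ∀ x ∈ segment ℝ (D.vertex i) (D.vertex (i + 1)) ∩
      segment ℝ (D.strandStart p) (D.strandEnd p),
    x ∈ openSegment ℝ (D.vertex i) (D.vertex (i + 1)) ∧
      x ∈ openSegment ℝ (D.strandStart p) (D.strandEnd p) ∧
      planeCross (D.dir i) (D.dir p.1) ≠ 0) ∧
  ∑ i, ∑ p ∈ boundaryComponent N, D.crossingSign i p = 2 * k

/-! #### The knot type -/

/-- A polygonal path in three-space over edge `i`: it joins the points at the heights `z i`,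
`z (i + 1)` over the end points of the edge through the points at the heights `a.2` over the points
that divide the edge in the ratio `a.1 : 1 - a.1`, for the listed pairs `a`. -/
def liftedEdge (z : Fin N → ℝ) (sub : Fin N → List (ℝ × ℝ)) (i : Fin N) : List (ℂ × ℝ) :=
  (D.vertex i, z i) ::
    ((sub i).map (fun a => (AffineMap.lineMap (D.vertex i) (D.vertex (i + 1)) a.1, a.2)) ++
      [(D.vertex (i + 1), z (i + 1))])

/-- The knot in three-space of which the polygon, with its over- and under-information, is a diagram
is an unknot. This knot is a polygonal knot in `ℂ × ℝ` which projects edge by edge to the polygon,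
and in which edge `i` passes above edge `j` wherever they meet in the plane and the piece of ribbon
along edge `i` is over the one along edge `j`. -/
def IsUnknot : Prop :=
  ∃ (z : Fin N → ℝ) (sub : Fin N → List (ℝ × ℝ)),
    (∀ i, (sub i).Pairwise (fun a b => a.1 < b.1) ∧ ∀ a ∈ sub i, 0 < a.1 ∧ a.1 < 1) ∧
    (∀ i j, D.Overlap i j → D.isOver i j →
      ∀ x ∈ polyline (D.liftedEdge z sub i), ∀ y ∈ polyline (D.liftedEdge z sub j),
        x.1 = y.1 → x ≠ y → y.2 < x.2) ∧
    IsPolygonalUnknot ((List.finRange N).flatMap fun i => (D.liftedEdge z sub i).dropLast)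

/-- The mirror image: all over- and under-information is interchanged. -/
def mirror : RibbonDiagram N := { D with isOver := fun i j => D.isOver j i }

end RibbonDiagram

/-! ### The multi-twist folded ribbon Möbius band -/

/-- The vertices of the Möbius band with an escape accordion of `2 m` folds and `2 n + 1` half-wraps,
fold angle `θ` and distance `d`. The vertices `0, …, 2 m + 2 n` form a zigzag along the real axis
with steps of length `d` and left turns at the even vertices, right turns at the odd ones: vertex `0`
is the start `v_S` of the escape accordion, vertex `2 m` is its end `v_E = w_1`, and the vertices
`2 m, …, 2 m + 2 n` are those of the half-wraps `w_1, …, w_{2 n + 1}`. Then come `E` and `A`, on a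
line at height `h` parallel to the real axis, placed so that the fold angle is `θ` at the vertices
`2 m + 2 n` and `0` as well. -/
def mobiusVertex (m n : ℕ) (θ d h : ℝ) (i : Fin (2 * m + 2 * n + 3)) : ℂ :=
  if (i : ℕ) ≤ 2 * m + 2 * n then
    ⟨(i : ℕ) * (d * Real.sin (θ / 2)), if Even (i : ℕ) then 0 else d * Real.cos (θ / 2)⟩
  else if (i : ℕ) = 2 * m + 2 * n + 1 then
    ⟨(2 * m + 2 * n : ℕ) * (d * Real.sin (θ / 2)) + h * Real.tan (θ / 2), h⟩
  else ⟨-(h * Real.tan (θ / 2)), h⟩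

/-- The stacking of the pieces of ribbon. The pieces `i < 2 m` of the escape accordion are stacked
upwards by overfolds, on top of the incoming piece from `A` to vertex `0`. From vertex `2 m` on, left
underfolds and right overfolds alternate, and the ribbon is wrapped around all that is there
already: the even pieces go to the bottom, the odd ones to the top. The last of the even pieces goes
from vertex `2 m + 2 n` to `E`. The piece from `E` to `A` is folded behind everything, with a left
underfold at `E` and a left overfold at `A`. -/
def mobiusLevel (m n : ℕ) (i : Fin (2 * m + 2 * n + 3)) : ℤ :=
  if (i : ℕ) < 2 * m then (i : ℕ)
  else if (i : ℕ) ≤ 2 * m + 2 * n then (if Even (i : ℕ) then -((i : ℕ) : ℤ) else (i : ℕ))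
  else if (i : ℕ) = 2 * m + 2 * n + 1 then -((i : ℕ) : ℤ)
  else -1

/-- The ribbon of width `1` constructed from an escape accordion with `2 m` folds followed by
`2 n + 1` half-wraps, with fold angle `θ` and distance `d`, and closed by folding the ends behind the
accordion at the points `E`, `A` at height `h`. -/
def mobiusBand (m n : ℕ) (θ d h : ℝ) : RibbonDiagram (2 * m + 2 * n + 3) where
  vertex := mobiusVertex m n θ d h
  width := 1
  isOver i j := mobiusLevel m n j < mobiusLevel m n i

/-- An accordion fold with `2 m > 0` folds, fold angle `θ` and distance `d > 0` is an escape accordion: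
the parallel pieces of ribbon that enter and leave it are at distance at least the width `1`. (Its
start and end are `2 m d sin (θ / 2)` apart, and the line joining them makes the angle
`π / 2 - θ / 2` with both pieces.) -/
def IsEscapeAccordion (m : ℕ) (θ d : ℝ) : Prop :=
  0 < m ∧ 0 < d ∧ 1 ≤ 2 * m * d * Real.sin (θ / 2) * Real.cos (θ / 2)

/-- The folded ribbonlengths of all folded ribbons that the construction gives with fold angle `θ` and
`2 n + 1` half-wraps. -/
def constructionLengths (n : ℕ) (θ : ℝ) : Set ℝ :=
  {L | ∃ (m : ℕ) (d h : ℝ), IsEscapeAccordion m θ d ∧ 0 < h ∧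
    (mobiusBand m n θ d h).IsFoldedRibbonKnot ∧ L = (mobiusBand m n θ d h).ribbonlength}

/-- The folded ribbonlength of the construction with fold angle `θ`, up to the terms that become
arbitrarily small for suitable `m`, `d` and `h`. -/
def limitRibbonlength (θ : ℝ) : ℝ :=
  2 / Real.cos (θ / 2) + 1 / (Real.cos (θ / 2) * Real.sin (θ / 2)) + Real.tan (θ / 2)

end

noncomputable section

/-! ### Plane geometry -/

/-! Write s = sin(θ/2), c = cos(θ/2) and K = 2m + 2n.

Length: the K zigzag edges have length d, the two oblique closing edges h/c, and the edge EA has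
length Kds + 2hs/c. So the ribbonlength is Kd(1+s) + 2h(1+s)/c (`IsZigzag.ribbonlength_eq`). The
escape condition gives Kd ≥ 1/(sc), and disjointness of the fold lines at w_{2n+1} and E forces h >
1/2 (`IsZigzag.half_lt_of_disjoint`). Both bounds are approached: with 2mdsc = 1 and m large, the
extra half-wraps cost only a multiple of n/m. The infimum is therefore (1+s)/(sc) + (1+s)/c =
(1+s)²/(sc), whatever n is. Comparing squares with 27 leaves the factor (2s-1)²(7s+1)(1+s), which
vanishes only at s = 1/2.

Foldability (`mobiusBand_isFoldedRibbonKnot`): the pieces have distinct integer levels, so stacking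
is automatic. A piece whose level lies between those of a fold is kept off the fold line by a
separating line. The escape condition is what separates the half-wraps from the piece entering v_S
and from the fold at A.

Topology: the number of edges is odd, so following the boundary once around changes sides and the
band is a Möbius band. For dc < h the polygon is planar and simple; removing its vertices one at a
time through a fan of triangles at v_S leaves a triangle (`IsZigzag.isUnknot`).

Linking number: for 2mdsc = 1 and m odd, in the coordinates x/(ds), y/(dc) the oblique edges lie on
lines of slope ±1 through even integers of the axis, and their boundary strands are shifted by the
odd number m. Hence crossings among them occur only at height 1/2, between edges whose positions
along the ribbon differ by exactly m (`IsZigzag.crosses_of_linePoint_eq`, `sum_crosses`). The signs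
alternate along the accordion and cancel, each half-wrap contributes +1, and the two crossings with
the edge EA cancel. Counting each pair twice, the sum of the signs is 2(2n+1) (`sum_contributions`).
Negative k come from mirror images. -/

theorem segment_add_smul {V : Type*} [AddCommGroup V] [Module ℝ V] (p v : V) (a b : ℝ) :
    segment ℝ (p + a • v) (p + b • v) = (fun u : ℝ => p + u • v) '' Set.uIcc a b := by
  have h := image_segment ℝ (AffineMap.lineMap p (p + v) : ℝ →ᵃ[ℝ] V) a b
  simp only [AffineMap.lineMap_apply, vsub_eq_sub, add_sub_cancel_left, vadd_eq_add] at h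
  rw [add_comm p, add_comm p, ← h, segment_eq_uIcc]
  exact Set.image_congr fun u _ => by
    simp [AffineMap.lineMap_apply, add_comm]

theorem add_smul_mem_openSegment {V : Type*} [AddCommGroup V] [Module ℝ V] (p v : V)
    {a b u : ℝ} (h : a < u ∧ u < b ∨ b < u ∧ u < a) :
    p + u • v ∈ openSegment ℝ (p + a • v) (p + b • v) := by
  have hab : u ∈ openSegment ℝ a b := by
    rcases h with h | h
    · rw [openSegment_eq_Ioo (h.1.trans h.2)]
      exact h
    · rw [openSegment_symm, openSegment_eq_Ioo (h.1.trans h.2)]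
      exact h
  have h := Set.mem_image_of_mem (AffineMap.lineMap p (p + v) : ℝ →ᵃ[ℝ] V) hab
  rw [image_openSegment] at h
  simpa only [AffineMap.lineMap_apply, vsub_eq_sub, add_sub_cancel_left, vadd_eq_add,
    add_comm _ p] using h

/-- A linear functional on the plane that is at most `C` on a set is less than `C` on its interior. -/
theorem lt_of_mem_interior_of_le {S : Set ℂ} {α β C : ℝ} (hαβ : 0 < α ^ 2 + β ^ 2)
    (hS : ∀ z ∈ S, α * z.re + β * z.im ≤ C) {z : ℂ} (hz : z ∈ interior S) :
    α * z.re + β * z.im < C := by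
  -- Moving a little from z in the direction (α, β) stays in S and strictly increases the
  -- functional.
  have hcont : Continuous fun δ : ℝ => z + (δ : ℂ) * ⟨α, β⟩ := by fun_prop
  have hnhds : ∀ᶠ δ : ℝ in nhds (0 : ℝ), z + (δ : ℂ) * ⟨α, β⟩ ∈ S := by
    refine hcont.continuousAt.eventually_mem ?_
    simpa using mem_interior_iff_mem_nhds.1 hz
  obtain ⟨δ, hδS, hδ⟩ := ((hnhds.filter_mono nhdsWithin_le_nhds).and
    (self_mem_nhdsWithin : Set.Ioi (0 : ℝ) ∈ nhdsWithin 0 (Set.Ioi 0))).exists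
  have h := hS _ hδS
  simp only [Complex.add_re, Complex.mul_re, Complex.ofReal_re, Complex.ofReal_im, zero_mul,
    sub_zero, Complex.add_im, Complex.mul_im, add_zero] at h
  have : 0 < δ * (α ^ 2 + β ^ 2) := mul_pos hδ hαβ
  nlinarith

theorem convex_functional_le (α β C : ℝ) : Convex ℝ {z : ℂ | α * z.re + β * z.im ≤ C} := by
  have h : IsLinearMap ℝ fun z : ℂ => α * z.re + β * z.im :=
    { map_add := fun x y => by simp; ring
      map_smul := fun a x => by simp; ring }
  exact convex_halfSpace_le h C

/-- Two segments in different directions have at most one point in common. -/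
theorem subsingleton_inter_of_planeCross_ne_zero {P Q v w : ℂ} (h : planeCross v w ≠ 0) :
    ¬ (segment ℝ (P - v) (P + v) ∩ segment ℝ (Q - w) (Q + w)).Nontrivial := by
  have key : ∀ (P v z : ℂ), z ∈ segment ℝ (P - v) (P + v) → ∃ u : ℝ, z = P + u • v := by
    intro P v z hz
    have := segment_add_smul P v (-1) 1
    simp only [neg_smul, one_smul, ← sub_eq_add_neg] at this
    rw [this] at hz
    obtain ⟨u, -, rfl⟩ := hz
    exact ⟨u, rfl⟩
  rintro ⟨x, ⟨hx1, hx2⟩, y, ⟨hy1, hy2⟩, hxy⟩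
  obtain ⟨a, ha⟩ := key _ _ _ hx1
  obtain ⟨b, hb⟩ := key _ _ _ hy1
  obtain ⟨a', ha'⟩ := key _ _ _ hx2
  obtain ⟨b', hb'⟩ := key _ _ _ hy2
  have e : (a - b) • v = (a' - b') • w := by
    have h1 : P + a • v = Q + a' • w := ha ▸ ha'
    have h2 : P + b • v = Q + b' • w := hb ▸ hb'
    have := congrArg₂ (· - ·) h1 h2
    simpa [sub_smul] using this
  have e2 : (a - b) * planeCross v w = 0 := by
    have hre := congrArg Complex.re e
    have him := congrArg Complex.im e
    simp only [Complex.real_smul, Complex.mul_re, Complex.ofReal_re, Complex.ofReal_im, zero_mul,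
      sub_zero, Complex.mul_im, add_zero] at hre him
    simp only [planeCross, Complex.mul_im, Complex.conj_re, Complex.conj_im]
    linear_combination w.im * hre - w.re * him
  have : a = b := by
    rcases mul_eq_zero.1 e2 with h' | h'
    · linarith
    · exact absurd h' h
  exact hxy (by rw [ha, hb, this])

/-! ### Zigzag diagrams -/

/-- The vertices of a zigzag with `K` edges of length `d` and directions `s ± i c`, followed by two
vertices at height `h`. -/
def zigzagVertex (K : ℕ) (s c d h : ℝ) (i : ℕ) : ℂ :=
  if i ≤ K then ⟨i * (d * s), if Even i then 0 else d * c⟩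
  else if i = K + 1 then ⟨K * (d * s) + h * (s / c), h⟩
  else ⟨-(h * (s / c)), h⟩

/-- The ribbon of width `1` along a zigzag whose ends are joined at height `h`. -/
def zigzagDiagram (K : ℕ) (s c d h : ℝ) (covers : Fin (K + 3) → Fin (K + 3) → Prop) :
    RibbonDiagram (K + 3) where
  vertex i := zigzagVertex K s c d h i
  width := 1
  isOver := covers

/-- The unit directions of the edges. -/
def zigzagDir (K : ℕ) (s c : ℝ) (i : ℕ) : ℂ :=
  if i = K + 1 then -1 else if i ≤ K ∧ Even i then ⟨s, c⟩ else ⟨s, -c⟩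

/-- The lengths of the edges. -/
def zigzagLen (K : ℕ) (s c d h : ℝ) (i : ℕ) : ℝ :=
  if i < K then d else if i = K + 1 then K * (d * s) + 2 * (h * (s / c)) else h / c

/-- The halves of the fold lines. -/
def zigzagFold (K : ℕ) (s c : ℝ) (i : ℕ) : ℂ :=
  if i ≤ K then (if Even i then ⟨-(1 / (2 * c)), 0⟩ else ⟨1 / (2 * c), 0⟩)
  else if i = K + 1 then ⟨c / (2 * (1 + s)), -(1 / 2)⟩
  else ⟨c / (2 * (1 + s)), 1 / 2⟩

/-- The conditions on the parameters of a zigzag diagram. -/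
structure IsZigzag (K : ℕ) (s c d h : ℝ) : Prop where
  even : Even K
  two_le : 2 ≤ K
  s_pos : 0 < s
  c_pos : 0 < c
  sq : s ^ 2 + c ^ 2 = 1
  d_pos : 0 < d
  h_pos : 0 < h

theorem fin_val_add_one {K : ℕ} (i : Fin (K + 3)) :
    ((i + 1 : Fin (K + 3)) : ℕ) = if (i : ℕ) = K + 2 then 0 else (i : ℕ) + 1 := by
  rw [Fin.val_add_one]
  simp only [Fin.ext_iff, Fin.val_last]

theorem fin_val_sub_one {K : ℕ} (i : Fin (K + 3)) :
    ((i - 1 : Fin (K + 3)) : ℕ) = if (i : ℕ) = 0 then K + 2 else (i : ℕ) - 1 := by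
  rw [Fin.coe_sub_one]
  simp only [Fin.ext_iff, Fin.val_zero]

namespace IsZigzag

variable {K : ℕ} {s c d h : ℝ} {covers : Fin (K + 3) → Fin (K + 3) → Prop}

theorem index_cases {i : ℕ} (hi : i < K + 3) :
    (i < K ∧ Even i) ∨ (i < K ∧ ¬ Even i) ∨ i = K ∨ i = K + 1 ∨ i = K + 2 := by
  by_cases h : Even i
  · simp only [h, and_true, not_true, and_false]
    omega
  · simp only [h, and_false, not_false_iff, and_true]
    omega

theorem norm_dir (Z : IsZigzag K s c d h) (i : ℕ) : ‖zigzagDir K s c i‖ = 1 := by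
  have h1 : s * s + c * c = 1 := by linear_combination Z.sq
  have e1 : ‖(⟨s, c⟩ : ℂ)‖ = 1 := by
    rw [Complex.norm_def, Complex.normSq_mk, h1, Real.sqrt_one]
  have e2 : ‖(⟨s, -c⟩ : ℂ)‖ = 1 := by
    rw [Complex.norm_def, Complex.normSq_mk, neg_mul_neg, h1, Real.sqrt_one]
  unfold zigzagDir
  split_ifs
  · simp
  · exact e1
  · exact e2

theorem len_pos (Z : IsZigzag K s c d h) (i : ℕ) : 0 < zigzagLen K s c d h i := by
  have := Z.s_pos
  have := Z.c_pos
  have := Z.d_pos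
  have := Z.h_pos
  unfold zigzagLen
  split_ifs <;> positivity

theorem vertex_sub (Z : IsZigzag K s c d h) (i : Fin (K + 3)) :
    (zigzagDiagram K s c d h covers).vertex (i + 1) - (zigzagDiagram K s c d h covers).vertex i =
      ((zigzagLen K s c d h i : ℝ) : ℂ) * zigzagDir K s c i := by
  have hc := Z.c_pos.ne'
  have hK := Z.even
  simp only [zigzagDiagram, fin_val_add_one]
  generalize hj : (i : ℕ) = j
  have hjK : j < K + 3 := hj ▸ i.2
  rcases index_cases hjK with ⟨h1, h2⟩ | ⟨h1, h2⟩ | h1 | h1 | h1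
  · have h3 : ¬ Even (j + 1) := by rwa [Nat.even_add_one, not_not]
    simp only [zigzagVertex, zigzagLen, zigzagDir, if_neg (show j ≠ K + 2 by omega),
      if_pos (show j + 1 ≤ K by omega), if_pos h1.le, if_pos h1, if_neg (show j ≠ K + 1 by omega),
      h2, h3, if_true, if_false, and_true]
    apply Complex.ext <;> simp
    ring
  · have h3 : Even (j + 1) := by rwa [Nat.even_add_one]
    simp only [zigzagVertex, zigzagLen, zigzagDir, if_neg (show j ≠ K + 2 by omega),
      if_pos (show j + 1 ≤ K by omega), if_pos h1.le, if_pos h1, if_neg (show j ≠ K + 1 by omega),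
      h2, h3, if_true, if_false, and_false]
    apply Complex.ext <;> simp
    ring
  · subst h1
    apply Complex.ext <;> simp [zigzagVertex, zigzagLen, zigzagDir, hK] <;> field_simp
  · subst h1
    apply Complex.ext <;> simp [zigzagVertex, zigzagLen, zigzagDir]
    ring
  · subst h1
    apply Complex.ext <;> simp [zigzagVertex, zigzagLen, zigzagDir] <;> field_simp

theorem dir_eq (Z : IsZigzag K s c d h) (i : Fin (K + 3)) :
    (zigzagDiagram K s c d h covers).dir i = zigzagDir K s c i := by
  have hl := Z.len_pos i
  rw [RibbonDiagram.dir, Z.vertex_sub, norm_mul, Z.norm_dir, mul_one, Complex.norm_real,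
    Real.norm_of_nonneg hl.le, ← mul_assoc, ← Complex.ofReal_mul, inv_mul_cancel₀ hl.ne',
    Complex.ofReal_one, one_mul]

theorem length_eq (Z : IsZigzag K s c d h) :
    (zigzagDiagram K s c d h covers).length = K * d * (1 + s) + 2 * h * ((1 + s) / c) := by
  have e : ∀ i : Fin (K + 3), ‖(zigzagDiagram K s c d h covers).vertex (i + 1) -
      (zigzagDiagram K s c d h covers).vertex i‖ = zigzagLen K s c d h i := fun i => by
    rw [Z.vertex_sub, norm_mul, Z.norm_dir, mul_one, Complex.norm_real,
      Real.norm_of_nonneg (Z.len_pos i).le]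
  have hc := Z.c_pos.ne'
  rw [RibbonDiagram.length, Finset.sum_congr rfl fun i _ => e i,
    Fin.sum_univ_eq_sum_range (fun i => zigzagLen K s c d h i), Finset.sum_range_succ,
    Finset.sum_range_succ, Finset.sum_range_succ,
    Finset.sum_congr rfl fun i hi => show zigzagLen K s c d h i = d by
      rw [zigzagLen, if_pos (Finset.mem_range.1 hi)]]
  simp [zigzagLen]
  field_simp
  ring

theorem ribbonlength_eq (Z : IsZigzag K s c d h) :
    (zigzagDiagram K s c d h covers).ribbonlength =
      K * d * (1 + s) + 2 * h * ((1 + s) / c) := by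
  rw [RibbonDiagram.ribbonlength, Z.length_eq]
  simp [zigzagDiagram]

/-- These differences determine both the fold lines and the fold angles: their squared norms are 4c²
on the zigzag and 2(1+s) at E and A. -/
theorem dir_sub (Z : IsZigzag K s c d h) (i : Fin (K + 3)) :
    zigzagDir K s c i - zigzagDir K s c (i - 1 : Fin (K + 3)) =
      if (i : ℕ) ≤ K then (if Even (i : ℕ) then ⟨0, 2 * c⟩ else ⟨0, -(2 * c)⟩)
      else if (i : ℕ) = K + 1 then ⟨-(1 + s), -c⟩ else ⟨1 + s, -c⟩ := by
  have hK := Z.even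
  have hK2 := Z.two_le
  rw [fin_val_sub_one]
  generalize hj : (i : ℕ) = j
  have hjK : j < K + 3 := hj ▸ i.2
  by_cases h0 : j = 0
  · subst h0
    have h2 : ¬ (K + 2 ≤ K) := by omega
    apply Complex.ext <;> simp [zigzagDir, h2]
    ring
  rw [if_neg h0]
  have hp : Even j ↔ ¬ Even (j - 1) := by
    rw [← Nat.even_add_one, Nat.sub_add_cancel (by omega)]
  rcases lt_trichotomy j (K + 1) with h1 | h1 | h1
  · simp only [zigzagDir, if_neg (show j ≠ K + 1 by omega), if_neg (show j - 1 ≠ K + 1 by omega),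
      show j ≤ K by omega, show j - 1 ≤ K by omega, true_and, if_true, hp]
    by_cases he : Even (j - 1)
    · simp only [he, not_true, if_true, if_false]
      apply Complex.ext <;> simp
      ring
    · simp only [he, not_false_iff, if_true, if_false]
      apply Complex.ext <;> simp
      ring
  · subst h1
    apply Complex.ext <;> simp [zigzagDir, hK]
    ring
  · obtain rfl : j = K + 2 := by omega
    have h2 : ¬ (K + 2 ≤ K) := by omega
    apply Complex.ext <;> simp [zigzagDir, h2]
    ring

theorem dir_ne (Z : IsZigzag K s c d h) (i : Fin (K + 3)) :
    (zigzagDiagram K s c d h covers).dir i ≠ (zigzagDiagram K s c d h covers).dir (i - 1) := by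
  have hc := Z.c_pos
  rw [Z.dir_eq, Z.dir_eq, ← sub_ne_zero, Z.dir_sub]
  intro h0
  have him := congrArg Complex.im h0
  split_ifs at him <;> simp at him <;> linarith

theorem foldVec_eq (Z : IsZigzag K s c d h) (i : Fin (K + 3)) :
    (zigzagDiagram K s c d h covers).foldVec i = zigzagFold K s c i := by
  have hc := Z.c_pos
  have hs := Z.s_pos
  have hsq := Z.sq
  rw [RibbonDiagram.foldVec, Z.dir_eq, Z.dir_eq, Z.dir_sub, ← Complex.normSq_eq_norm_sq]
  have e1 : Complex.normSq ⟨-(1 + s), -c⟩ = 2 * (1 + s) := by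
    rw [Complex.normSq_mk]
    linear_combination hsq
  have e2 : Complex.normSq ⟨1 + s, -c⟩ = 2 * (1 + s) := by
    rw [Complex.normSq_mk]
    linear_combination hsq
  have h1s : 1 + s ≠ 0 := by positivity
  simp only [zigzagFold, zigzagDiagram]
  split_ifs
  · apply Complex.ext <;> simp
    field_simp
  · apply Complex.ext <;> simp
    field_simp
  · rw [e1]
    apply Complex.ext
    · rw [Complex.re_ofReal_mul, Complex.I_mul_re]
      simp only [neg_neg]
      field_simp
    · rw [Complex.im_ofReal_mul, Complex.I_mul_im]
      field_simp
  · rw [e2]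
    apply Complex.ext
    · rw [Complex.re_ofReal_mul, Complex.I_mul_re]
      simp only [neg_neg]
      field_simp
    · rw [Complex.im_ofReal_mul, Complex.I_mul_im]
      field_simp

end IsZigzag

/-! ### Faces, fold lines and mirror images of a general diagram. -/

namespace RibbonDiagram

variable {N : ℕ} [NeZero N] (D : RibbonDiagram N)

theorem mem_foldLine {i : Fin N} {z : ℂ} :
    z ∈ D.foldLine i ↔ ∃ u : ℝ, -1 ≤ u ∧ u ≤ 1 ∧ z = D.vertex i + u • D.foldVec i := by
  have h := segment_add_smul (D.vertex i) (D.foldVec i) (-1) 1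
  simp only [neg_smul, one_smul, ← sub_eq_add_neg] at h
  rw [foldLine, h, Set.uIcc_of_le (by norm_num)]
  constructor
  · rintro ⟨u, ⟨h1, h2⟩, rfl⟩
    exact ⟨u, h1, h2, rfl⟩
  · rintro ⟨u, h1, h2, rfl⟩
    exact ⟨u, ⟨h1, h2⟩, rfl⟩

/-- The tool for separating pieces by lines. The absolute values account for both ends of a fold
line at once, so two inequalities control all four corners of the face. -/
theorem lt_of_mem_interior_face {i : Fin N} {α β C : ℝ} (hαβ : 0 < α ^ 2 + β ^ 2)
    (h1 : α * (D.vertex i).re + β * (D.vertex i).im +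
      |α * (D.foldVec i).re + β * (D.foldVec i).im| ≤ C)
    (h2 : α * (D.vertex (i + 1)).re + β * (D.vertex (i + 1)).im +
      |α * (D.foldVec (i + 1)).re + β * (D.foldVec (i + 1)).im| ≤ C)
    {z : ℂ} (hz : z ∈ interior (D.face i)) : α * z.re + β * z.im < C := by
  refine lt_of_mem_interior_of_le hαβ (S := D.face i) ?_ hz
  suffices hs : D.face i ⊆ {z : ℂ | α * z.re + β * z.im ≤ C} from fun z hz => by
    simpa using hs hz
  refine convexHull_min ?_ (convex_functional_le α β C)
  have a1 := le_abs_self (α * (D.foldVec i).re + β * (D.foldVec i).im)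
  have a2 := neg_abs_le (α * (D.foldVec i).re + β * (D.foldVec i).im)
  have a3 := le_abs_self (α * (D.foldVec (i + 1)).re + β * (D.foldVec (i + 1)).im)
  have a4 := neg_abs_le (α * (D.foldVec (i + 1)).re + β * (D.foldVec (i + 1)).im)
  intro z hz
  rw [Set.mem_ofPred_eq]
  simp only [Set.mem_insert_iff, Set.mem_singleton_iff] at hz
  rcases hz with rfl | rfl | rfl | rfl <;>
    simp only [Complex.sub_re, Complex.sub_im, Complex.add_re, Complex.add_im] <;>
    linarith

theorem mirror_between {i j k : Fin N} : D.mirror.Between i j k ↔ D.Between i j k := by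
  simp only [Between, mirror]
  tauto

theorem IsFoldedRibbonKnot.mirror {D : RibbonDiagram N} (hD : D.IsFoldedRibbonKnot) :
    D.mirror.IsFoldedRibbonKnot where
  width_pos := hD.width_pos
  vertex_ne := hD.vertex_ne
  dir_ne := hD.dir_ne
  foldLine_disjoint := hD.foldLine_disjoint
  over_xor i j hij ho := (xor_comm _ _).mp (hD.over_xor i j hij ho)
  over_trans i j k hz hij hjk := by
    refine hD.over_trans k j i ?_ hjk hij
    obtain ⟨z, ⟨h1, h2⟩, h3⟩ := hz
    exact ⟨z, ⟨h3, h2⟩, h1⟩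
  not_through_fold i j h1 h2 h3 h4 := hD.not_through_fold i j h1 h2 h3 (D.mirror_between.1 h4)
  not_interleaved i j h1 h2 h3 := by
    rw [mirror_between, mirror_between]
    exact hD.not_interleaved i j h1 h2 h3

end RibbonDiagram

/-! ### Half-planes and strips containing the faces and fold lines of a zigzag. -/

namespace IsZigzag

variable {K : ℕ} {s c d h : ℝ} {covers : Fin (K + 3) → Fin (K + 3) → Prop}

theorem one_add_ne (Z : IsZigzag K s c d h) : 1 + s ≠ 0 := by
  have := Z.s_pos
  positivity

/-- This is the horizontal half-extent of the fold lines at E and A; the right-hand form is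
comparable with the half-length 1/(2c) of the fold lines of the zigzag. -/
theorem div_one_add (Z : IsZigzag K s c d h) : c / (2 * (1 + s)) = (1 - s) / (2 * c) := by
  have := Z.one_add_ne
  have := Z.c_pos.ne'
  field_simp
  linear_combination Z.sq

/-- No piece can pass through a fold at an even vertex of the zigzag, because those fold lines lie
on the real axis. The condition h > 1/2 keeps the lower ends of the fold lines at E and A above the
axis. -/
theorem interior_face_im_pos (Z : IsZigzag K s c d h) (hh : 1 / 2 < h) {j : Fin (K + 3)} {z : ℂ}
    (hz : z ∈ interior ((zigzagDiagram K s c d h covers).face j)) : 0 < z.im := by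
  have hc := Z.c_pos
  have hd := Z.d_pos
  have key : ∀ i : Fin (K + 3), 0 * ((zigzagDiagram K s c d h covers).vertex i).re +
      (-1) * ((zigzagDiagram K s c d h covers).vertex i).im +
      |0 * ((zigzagDiagram K s c d h covers).foldVec i).re +
        (-1) * ((zigzagDiagram K s c d h covers).foldVec i).im| ≤ 0 := by
    intro i
    rw [Z.foldVec_eq]
    simp only [zigzagDiagram, zigzagVertex, zigzagFold]
    split_ifs
    · simp
    · simp
      positivity
    · simp only [zero_mul, zero_add, neg_mul, one_mul, neg_neg]
      rw [abs_of_pos (by norm_num)]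
      linarith
    · simp only [zero_mul, zero_add, neg_mul, one_mul, abs_neg]
      rw [abs_of_pos (by norm_num)]
      linarith
  have := (zigzagDiagram K s c d h covers).lt_of_mem_interior_face (by norm_num) (key j)
    (key (j + 1)) hz
  linarith

/-- Only the three closing pieces can meet the fold lines at odd vertices, which have height d c. -/
theorem interior_face_im_lt (Z : IsZigzag K s c d h) {j : Fin (K + 3)} (hj : (j : ℕ) < K) {z : ℂ}
    (hz : z ∈ interior ((zigzagDiagram K s c d h covers).face j)) : z.im < d * c := by
  have hc := Z.c_pos
  have hd := Z.d_pos
  have key : ∀ i : Fin (K + 3), (i : ℕ) ≤ K → 0 * ((zigzagDiagram K s c d h covers).vertex i).re +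
      1 * ((zigzagDiagram K s c d h covers).vertex i).im +
      |0 * ((zigzagDiagram K s c d h covers).foldVec i).re +
        1 * ((zigzagDiagram K s c d h covers).foldVec i).im| ≤ d * c := by
    intro i hi
    rw [Z.foldVec_eq]
    simp only [zigzagDiagram, zigzagVertex, zigzagFold, if_pos hi]
    split_ifs
    · simp
      positivity
    · simp
  have := (zigzagDiagram K s c d h covers).lt_of_mem_interior_face (by norm_num) (key j hj.le)
    (key (j + 1) (by rw [fin_val_add_one]; split_ifs <;> omega)) hz
  linarith

/-- The bounding line carries the right-hand border of the piece from A to vertex 0. -/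
theorem interior_last_face_lt (Z : IsZigzag K s c d h) {j : Fin (K + 3)} (hj : (j : ℕ) = K + 2)
    {z : ℂ} (hz : z ∈ interior ((zigzagDiagram K s c d h covers).face j)) :
    z.re + s / c * z.im < 1 / (2 * c) := by
  have hc := Z.c_pos
  have hs := Z.s_pos
  have hd := Z.div_one_add
  have hj' : ((j + 1 : Fin (K + 3)) : ℕ) = 0 := by rw [fin_val_add_one, if_pos hj]
  have e : c / (2 * (1 + s)) + s / c * (1 / 2) = 1 / (2 * c) := by
    rw [hd]
    field_simp
    ring
  have := (zigzagDiagram K s c d h covers).lt_of_mem_interior_face (α := 1) (β := s / c)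
    (C := 1 / (2 * c)) (i := j) (by positivity) (by
      rw [Z.foldVec_eq]
      simp only [zigzagDiagram, hj, zigzagVertex, zigzagFold, if_neg (show ¬ (K + 2 ≤ K) by omega),
        if_neg (show ¬ (K + 2 = K + 1) by omega), one_mul]
      rw [e, abs_of_pos (by positivity)]
      apply le_of_eq
      ring) (by
      rw [Z.foldVec_eq]
      simp only [zigzagDiagram, hj', zigzagVertex, zigzagFold]
      simp [abs_of_pos hc]) hz
  linarith

/-- The bounding line carries the left-hand border of the rising piece j. Together with the strip at
A this separates pieces at least 1/c further along the axis from that fold. -/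
theorem lt_interior_even_face (Z : IsZigzag K s c d h) {j : Fin (K + 3)} (hj : (j : ℕ) ≤ K)
    (he : Even (j : ℕ)) {z : ℂ} (hz : z ∈ interior ((zigzagDiagram K s c d h covers).face j)) :
    j * (d * s) - 1 / (2 * c) < z.re - s / c * z.im := by
  have hc := Z.c_pos
  have hs := Z.s_pos
  have hd := Z.div_one_add
  have hj' : ((j + 1 : Fin (K + 3)) : ℕ) = j + 1 := by rw [fin_val_add_one, if_neg (by omega)]
  have ho : ¬ Even ((j : ℕ) + 1) := by rwa [Nat.even_add_one, not_not]
  have e : -1 * (c / (2 * (1 + s))) + s / c * -(1 / 2) = -(1 / (2 * c)) := by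
    rw [hd]
    field_simp
    ring
  have := (zigzagDiagram K s c d h covers).lt_of_mem_interior_face (α := -1) (β := s / c)
    (C := 1 / (2 * c) - j * (d * s)) (i := j) (by positivity) (by
      rw [Z.foldVec_eq]
      simp only [zigzagDiagram, zigzagVertex, zigzagFold, if_pos hj, if_pos he]
      simp [abs_of_pos hc]) (by
      rw [Z.foldVec_eq]
      simp only [zigzagDiagram, hj', zigzagVertex, zigzagFold]
      rcases Nat.lt_or_ge j K with hK | hK
      · simp only [if_pos (show (j : ℕ) + 1 ≤ K by omega), if_neg ho]
        simp [abs_of_pos hc]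
        field_simp
        linarith
      · obtain hK : (j : ℕ) = K := by omega
        rw [hK, if_neg (show ¬ (K + 1 ≤ K) by omega), if_pos rfl,
          if_neg (show ¬ (K + 1 ≤ K) by omega), if_pos rfl]
        simp only [e, abs_neg]
        rw [abs_of_pos (by positivity)]
        apply le_of_eq
        ring) hz
  linarith

theorem vertex_eq_of_le {i : Fin (K + 3)} (hi : (i : ℕ) ≤ K) :
    (zigzagDiagram K s c d h covers).vertex i =
      ⟨(i : ℕ) * (d * s), if Even (i : ℕ) then 0 else d * c⟩ := by
  simp only [zigzagDiagram, zigzagVertex, if_pos hi]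

theorem vertex_eq_of_eq {i : Fin (K + 3)} (hi : (i : ℕ) = K + 1) :
    (zigzagDiagram K s c d h covers).vertex i = ⟨K * (d * s) + h * (s / c), h⟩ := by
  simp [zigzagDiagram, zigzagVertex, hi]

theorem vertex_eq_of_eq' {i : Fin (K + 3)} (hi : (i : ℕ) = K + 2) :
    (zigzagDiagram K s c d h covers).vertex i = ⟨-(h * (s / c)), h⟩ := by
  simp [zigzagDiagram, zigzagVertex, hi]

theorem fold_eq_of_eq {i : ℕ} (hi : i = K + 1) :
    zigzagFold K s c i = ⟨c / (2 * (1 + s)), -(1 / 2)⟩ := by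
  simp [zigzagFold, hi]

theorem fold_eq_of_eq' {i : ℕ} (hi : i = K + 2) :
    zigzagFold K s c i = ⟨c / (2 * (1 + s)), 1 / 2⟩ := by
  simp [zigzagFold, hi]

theorem fold_im_of_le {i : ℕ} (hi : i ≤ K) : (zigzagFold K s c i).im = 0 := by
  rw [zigzagFold, if_pos hi]
  split_ifs <;> rfl

theorem fold_re_of_le (Z : IsZigzag K s c d h) {i : ℕ} (hi : i ≤ K) :
    |(zigzagFold K s c i).re| = 1 / (2 * c) := by
  have hc := Z.c_pos
  rw [zigzagFold, if_pos hi]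
  split_ifs <;> simp [abs_of_pos hc]

/-- Points on the fold lines of the zigzag. -/
theorem mem_foldLine_of_le (Z : IsZigzag K s c d h) {i : Fin (K + 3)} (hi : (i : ℕ) ≤ K) {z : ℂ}
    (hz : z ∈ (zigzagDiagram K s c d h covers).foldLine i) :
    z.im = (if Even (i : ℕ) then 0 else d * c) ∧ |z.re - i * (d * s)| ≤ 1 / (2 * c) := by
  obtain ⟨u, h1, h2, rfl⟩ := (RibbonDiagram.mem_foldLine _).1 hz
  rw [Z.foldVec_eq, vertex_eq_of_le hi]
  constructor
  · simp [fold_im_of_le hi]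
  · simp only [Complex.add_re, Complex.real_smul, Complex.re_ofReal_mul, add_sub_cancel_left,
      abs_mul, Z.fold_re_of_le hi]
    have := Z.c_pos
    exact mul_le_of_le_one_left (by positivity) (abs_le.2 ⟨h1, h2⟩)

theorem mem_foldLine_last (Z : IsZigzag K s c d h) (hh : 1 / 2 < h) {i : Fin (K + 3)}
    (hi : (i : ℕ) = K + 2) {z : ℂ} (hz : z ∈ (zigzagDiagram K s c d h covers).foldLine i) :
    0 < z.im ∧ |z.re + s / c * z.im| ≤ 1 / (2 * c) := by
  obtain ⟨u, h1, h2, rfl⟩ := (RibbonDiagram.mem_foldLine _).1 hz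
  rw [Z.foldVec_eq, vertex_eq_of_eq' hi, fold_eq_of_eq' hi, Z.div_one_add]
  have hc := Z.c_pos
  constructor
  · simp
    linarith
  · have e : -(h * (s / c)) + u * ((1 - s) / (2 * c)) + s / c * (h + u * (1 / 2)) =
        u * (1 / (2 * c)) := by
      field_simp
      ring
    simp only [Complex.add_re, Complex.add_im, Complex.real_smul, Complex.re_ofReal_mul,
      Complex.im_ofReal_mul, e, abs_mul]
    rw [abs_of_pos (show 0 < 1 / (2 * c) by positivity)]
    exact mul_le_of_le_one_left (by positivity) (abs_le.2 ⟨h1, h2⟩)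

theorem mem_foldLine_E (Z : IsZigzag K s c d h) (hh : 1 / 2 < h) {i : Fin (K + 3)}
    (hi : (i : ℕ) = K + 1) {z : ℂ} (hz : z ∈ (zigzagDiagram K s c d h covers).foldLine i) :
    0 < z.im ∧ |z.re - K * (d * s) - s / c * z.im| ≤ 1 / (2 * c) ∧
      |z.re - K * (d * s) - h * (s / c)| ≤ (1 - s) / (2 * c) := by
  obtain ⟨u, h1, h2, rfl⟩ := (RibbonDiagram.mem_foldLine _).1 hz
  rw [Z.foldVec_eq, vertex_eq_of_eq hi, fold_eq_of_eq hi, Z.div_one_add]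
  have hc := Z.c_pos
  have hs := Z.s_pos
  have hu := abs_le.2 ⟨h1, h2⟩
  have hs1 : 0 < 1 - s := by nlinarith [Z.sq]
  refine ⟨?_, ?_, ?_⟩
  · simp
    linarith
  · have e : K * (d * s) + h * (s / c) + u * ((1 - s) / (2 * c)) - K * (d * s) -
        s / c * (h + u * -(1 / 2)) = u * (1 / (2 * c)) := by
      field_simp
      ring
    simp only [Complex.add_re, Complex.add_im, Complex.real_smul, Complex.re_ofReal_mul,
      Complex.im_ofReal_mul, e, abs_mul]
    rw [abs_of_pos (show 0 < 1 / (2 * c) by positivity)]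
    exact mul_le_of_le_one_left (by positivity) hu
  · have e : K * (d * s) + h * (s / c) + u * ((1 - s) / (2 * c)) - K * (d * s) - h * (s / c) =
        u * ((1 - s) / (2 * c)) := by ring
    simp only [Complex.add_re, Complex.real_smul, Complex.re_ofReal_mul, e, abs_mul]
    rw [abs_of_pos (show 0 < (1 - s) / (2 * c) by positivity)]
    exact mul_le_of_le_one_left (by positivity) hu

end IsZigzag

/-! ### Disjoint and overlapping fold lines. -/

namespace IsZigzag

variable {K : ℕ} {s c d h : ℝ} {covers : Fin (K + 3) → Fin (K + 3) → Prop}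

theorem mem_foldLine_A (Z : IsZigzag K s c d h) {i : Fin (K + 3)}
    (hi : (i : ℕ) = K + 2) {z : ℂ} (hz : z ∈ (zigzagDiagram K s c d h covers).foldLine i) :
    |z.re + h * (s / c)| ≤ (1 - s) / (2 * c) := by
  obtain ⟨u, h1, h2, rfl⟩ := (RibbonDiagram.mem_foldLine _).1 hz
  rw [Z.foldVec_eq, vertex_eq_of_eq' hi, fold_eq_of_eq' hi, Z.div_one_add]
  have hc := Z.c_pos
  have hs1 : 0 < 1 - s := by nlinarith [Z.sq, Z.s_pos]
  have e : -(h * (s / c)) + u * ((1 - s) / (2 * c)) + h * (s / c) = u * ((1 - s) / (2 * c)) := by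
    ring
  simp only [Complex.add_re, Complex.real_smul, Complex.re_ofReal_mul, e, abs_mul]
  rw [abs_of_pos (show 0 < (1 - s) / (2 * c) by positivity)]
  exact mul_le_of_le_one_left (by positivity) (abs_le.2 ⟨h1, h2⟩)

/-- Consecutive fold lines differ in height, except those at E and A. These two are separated
horizontally: together they reach at most (1-s)/c inwards, less than the distance of E and A. -/
theorem foldLine_disjoint (Z : IsZigzag K s c d h) (hh : 1 / 2 < h) (hK : 1 / c ≤ K * (d * s))
    (i : Fin (K + 3)) : Disjoint ((zigzagDiagram K s c d h covers).foldLine i)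
      ((zigzagDiagram K s c d h covers).foldLine (i + 1)) := by
  have hdc : 0 < d * c := mul_pos Z.d_pos Z.c_pos
  have hi1 := fin_val_add_one i
  rw [Set.disjoint_left]
  intro z hz hz'
  rcases index_cases i.2 with ⟨h1, h2⟩ | ⟨h1, h2⟩ | h1 | h1 | h1
  · rw [if_neg (by omega)] at hi1
    have a := (Z.mem_foldLine_of_le h1.le hz).1
    have b := (Z.mem_foldLine_of_le (by omega) hz').1
    rw [if_pos h2] at a
    rw [hi1, if_neg (by rwa [Nat.even_add_one, not_not])] at b
    linarith
  · rw [if_neg (by omega)] at hi1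
    have a := (Z.mem_foldLine_of_le h1.le hz).1
    have b := (Z.mem_foldLine_of_le (by omega) hz').1
    rw [if_neg h2] at a
    rw [hi1, if_pos (by rwa [Nat.even_add_one])] at b
    linarith
  · rw [if_neg (by omega)] at hi1
    have a := (Z.mem_foldLine_of_le h1.le hz).1
    have b := (Z.mem_foldLine_E hh (by omega) hz').1
    rw [h1, if_pos Z.even] at a
    linarith
  · rw [if_neg (by omega)] at hi1
    have a := abs_le.1 (Z.mem_foldLine_E hh h1 hz).2.2
    have b := abs_le.1 (Z.mem_foldLine_A (by omega) hz')
    have hht : 0 < h * (s / c) := mul_pos Z.h_pos (div_pos Z.s_pos Z.c_pos)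
    have e : (1 - s) / (2 * c) + (1 - s) / (2 * c) = 1 / c - s / c := by
      have := Z.c_pos.ne'
      field_simp
      ring
    have hsc : 0 < s / c := div_pos Z.s_pos Z.c_pos
    linarith [a.1, b.2]
  · rw [if_pos h1] at hi1
    have a := (Z.mem_foldLine_last hh h1 hz).1
    have b := (Z.mem_foldLine_of_le (by omega) hz').1
    rw [hi1, if_pos (by norm_num)] at b
    linarith

/-- The last fold line of the zigzag and the next one meet if they are too close. -/
theorem half_lt_of_disjoint (Z : IsZigzag K s c d h)
    (hdisj : ∀ i, Disjoint ((zigzagDiagram K s c d h covers).foldLine i)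
      ((zigzagDiagram K s c d h covers).foldLine (i + 1))) : 1 / 2 < h := by
  by_contra! hh
  have hc := Z.c_pos
  have hh0 := Z.h_pos
  let i : Fin (K + 3) := ⟨K, by omega⟩
  have hi : (i : ℕ) = K := rfl
  have hi1 : ((i + 1 : Fin (K + 3)) : ℕ) = K + 1 := by rw [fin_val_add_one, if_neg (by omega)]
  have key := Set.disjoint_left.1 (hdisj i)
  -- This is where the lines through the two fold lines meet; its parameters on them are -2h and 2h,
  -- so for h ≤ 1/2 it lies on both.
  refine @key ⟨K * (d * s) + h / c, 0⟩ ?_ ?_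
  · refine (RibbonDiagram.mem_foldLine _).2 ⟨-(2 * h), by linarith, by linarith, ?_⟩
    rw [Z.foldVec_eq, vertex_eq_of_le hi.le]
    simp only [zigzagFold, hi, le_refl, if_true, Z.even]
    apply Complex.ext <;> simp
    field_simp
  · refine (RibbonDiagram.mem_foldLine _).2 ⟨2 * h, by linarith, by linarith, ?_⟩
    rw [Z.foldVec_eq, vertex_eq_of_eq hi1, fold_eq_of_eq hi1, Z.div_one_add]
    apply Complex.ext
    · simp
      field_simp
      ring
    · simp
      ring

/-- Overlapping fold lines belong to vertices of the zigzag on the same level. -/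
theorem foldLine_inter (Z : IsZigzag K s c d h) {i j : Fin (K + 3)} (hij : i ≠ j)
    (hz : ((zigzagDiagram K s c d h covers).foldLine i ∩
      (zigzagDiagram K s c d h covers).foldLine j).Nontrivial) :
    (i : ℕ) ≤ K ∧ (j : ℕ) ≤ K ∧ (Even (i : ℕ) ↔ Even (j : ℕ)) := by
  have hc := Z.c_pos
  have hs := Z.s_pos
  have hdc : 0 < d * c := mul_pos Z.d_pos Z.c_pos
  -- More than one common point forces parallel fold lines, which excludes every pair involving E or
  -- A.
  have hcr : planeCross (zigzagFold K s c i) (zigzagFold K s c j) = 0 := by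
    by_contra h0
    refine subsingleton_inter_of_planeCross_ne_zero h0 ?_ (P :=
      (zigzagDiagram K s c d h covers).vertex i) (Q := (zigzagDiagram K s c d h covers).vertex j)
    simpa only [RibbonDiagram.foldLine, Z.foldVec_eq] using hz
  simp only [planeCross, Complex.mul_im, Complex.conj_re, Complex.conj_im] at hcr
  have hpos : 0 < c / (2 * (1 + s)) := by positivity
  have hpos' : 0 < 1 / (2 * c) := by positivity
  have hne : ∀ k : ℕ, k ≤ K → (zigzagFold K s c k).re ≠ 0 := fun k hk h0 => by
    have := Z.fold_re_of_le hk
    rw [h0, abs_zero] at this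
    exact hpos'.ne this
  have hv : (i : ℕ) ≠ j := fun e => hij (Fin.ext e)
  rcases Nat.lt_or_ge K i with hi | hi
  · exfalso
    rcases Nat.lt_or_ge K j with hj | hj
    · obtain ⟨h1, h2⟩ | ⟨h1, h2⟩ : (i : ℕ) = K + 1 ∧ (j : ℕ) = K + 2 ∨
          (i : ℕ) = K + 2 ∧ (j : ℕ) = K + 1 := by omega
      · rw [fold_eq_of_eq h1, fold_eq_of_eq' h2] at hcr
        simp only at hcr
        linarith
      · rw [fold_eq_of_eq' h1, fold_eq_of_eq h2] at hcr
        simp only at hcr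
        linarith
    · have := hne j hj
      obtain h1 | h1 : (i : ℕ) = K + 1 ∨ (i : ℕ) = K + 2 := by omega
      · rw [fold_eq_of_eq h1, fold_im_of_le hj] at hcr
        apply this
        simp only at hcr
        linarith
      · rw [fold_eq_of_eq' h1, fold_im_of_le hj] at hcr
        apply this
        simp only at hcr
        linarith
  · rcases Nat.lt_or_ge K j with hj | hj
    · exfalso
      have := hne i hi
      obtain h1 | h1 : (j : ℕ) = K + 1 ∨ (j : ℕ) = K + 2 := by omega
      · rw [fold_eq_of_eq h1, fold_im_of_le hi] at hcr
        apply this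
        simp only at hcr
        linarith
      · rw [fold_eq_of_eq' h1, fold_im_of_le hi] at hcr
        apply this
        simp only at hcr
        linarith
    · refine ⟨hi, hj, ?_⟩
      obtain ⟨z, hz1, hz2⟩ := hz.nonempty
      have e1 := (Z.mem_foldLine_of_le hi hz1).1
      have e2 := (Z.mem_foldLine_of_le hj hz2).1
      rw [e1] at e2
      by_cases p : Even (i : ℕ) <;> by_cases q : Even (j : ℕ) <;> simp only [p, q, if_true, if_false,
        iff_self, iff_true, iff_false, not_true] at e2 ⊢ <;> linarith

end IsZigzag

/-! ### The Möbius band -/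

theorem mobiusBand_eq (m n : ℕ) (θ d h : ℝ) :
    mobiusBand m n θ d h = zigzagDiagram (2 * m + 2 * n) (Real.sin (θ / 2)) (Real.cos (θ / 2)) d h
      (fun i j => mobiusLevel m n j < mobiusLevel m n i) := by
  have : mobiusVertex m n θ d h = fun i : Fin (2 * m + 2 * n + 3) => zigzagVertex (2 * m + 2 * n) (Real.sin (θ / 2))
      (Real.cos (θ / 2)) d h i := by
    funext i
    simp only [mobiusVertex, zigzagVertex, Real.tan_eq_sin_div_cos]
  rw [mobiusBand, zigzagDiagram, this]

theorem mirror_mobiusBand_eq (m n : ℕ) (θ d h : ℝ) :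
    (mobiusBand m n θ d h).mirror =
      zigzagDiagram (2 * m + 2 * n) (Real.sin (θ / 2)) (Real.cos (θ / 2)) d h
      (fun i j => mobiusLevel m n i < mobiusLevel m n j) := by
  rw [mobiusBand_eq]
  rfl

/-! ### Levels of the pieces in the stack. -/

section Level

variable {m n : ℕ}

theorem mobiusLevel_E {i : Fin (2 * m + 2 * n + 3)} (hi : (i : ℕ) = 2 * m + 2 * n + 1) :
    mobiusLevel m n i = -(2 * m + 2 * n + 1) := by
  simp only [mobiusLevel, hi]
  rw [if_neg (by omega), if_neg (by omega), if_true]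
  push_cast
  ring

theorem mobiusLevel_A {i : Fin (2 * m + 2 * n + 3)} (hi : (i : ℕ) = 2 * m + 2 * n + 2) :
    mobiusLevel m n i = -1 := by
  simp only [mobiusLevel, hi]
  rw [if_neg (by omega), if_neg (by omega), if_neg (by omega)]

theorem mobiusLevel_of_le {i : Fin (2 * m + 2 * n + 3)} (hi : (i : ℕ) ≤ 2 * m + 2 * n) :
    mobiusLevel m n i =
      if (i : ℕ) < 2 * m then ((i : ℕ) : ℤ) else if Even (i : ℕ) then -((i : ℕ) : ℤ) else (i : ℕ) := by
  simp only [mobiusLevel, if_pos hi]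

theorem mobiusLevel_injective (hm : 0 < m) : Function.Injective (mobiusLevel m n) := by
  intro i j hij
  have hi := i.2
  have hj := j.2
  apply Fin.ext
  simp only [mobiusLevel, Nat.even_iff] at hij
  split_ifs at hij <;> omega

/-- The level -1 of the incoming piece makes the accordion formula valid at vertex 0 too, where the
predecessor is the last edge. -/
theorem mobiusLevel_pred {i : Fin (2 * m + 2 * n + 3)} (hi : (i : ℕ) ≤ 2 * m + 2 * n) :
    mobiusLevel m n (i - 1) =
      if (i : ℕ) ≤ 2 * m then ((i : ℕ) : ℤ) - 1 else if Even (i : ℕ) then ((i : ℕ) : ℤ) - 1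
        else -(((i : ℕ) : ℤ) - 1) := by
  have h1 := fin_val_sub_one i
  by_cases h0 : (i : ℕ) = 0
  · rw [if_pos h0] at h1
    rw [mobiusLevel_A h1, if_pos (by omega), h0]
    norm_num
  · rw [if_neg h0] at h1
    rw [mobiusLevel_of_le (by omega), h1]
    simp only [Nat.even_iff]
    split_ifs <;> omega

end Level

/-- Comparing integer levels settles the order axioms. An accordion fold joins consecutive levels,
so nothing lies between them; a half-wrap encloses all earlier levels. What remains are the pairs
that the levels alone do not exclude, and these are separated geometrically. -/
theorem mobiusBand_isFoldedRibbonKnot {m n : ℕ} {s c d h : ℝ}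
    (Z : IsZigzag (2 * m + 2 * n) s c d h) (hm : 0 < m) (hh : 1 / 2 < h)
    (hK : 1 / c ≤ 2 * m * (d * s)) :
    (zigzagDiagram (2 * m + 2 * n) s c d h
      (fun i j => mobiusLevel m n j < mobiusLevel m n i)).IsFoldedRibbonKnot := by
  have hds : 0 < d * s := mul_pos Z.d_pos Z.s_pos
  have hc := Z.c_pos
  have hsc : 0 < s / c := div_pos Z.s_pos hc
  have hhalf : 1 / c = 1 / (2 * c) + 1 / (2 * c) := by
    field_simp
    ring
  have hle : ∀ k : ℕ, 2 * m ≤ k → 1 / c ≤ k * (d * s) := fun k hk => by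
    refine hK.trans ?_
    gcongr
    exact_mod_cast hk
  refine ⟨zero_lt_one, fun i => ?_, Z.dir_ne, Z.foldLine_disjoint hh (hle _ (by omega)), ?_, ?_, ?_,
    ?_⟩
  · rw [← sub_ne_zero, Z.vertex_sub]
    refine mul_ne_zero (Complex.ofReal_ne_zero.2 (Z.len_pos i).ne') ?_
    rw [← norm_ne_zero_iff, Z.norm_dir]
    exact one_ne_zero
  · intro i j hij _
    have := (mobiusLevel_injective (n := n) hm).ne hij
    simp only [zigzagDiagram, Xor]
    omega
  · intro i j k _ h1 h2
    exact lt_trans (show mobiusLevel m n k < mobiusLevel m n j from h2) h1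
  · rintro i j hji hji1 ⟨z, hzj, hzi⟩ hb
    have hb' : (mobiusLevel m n j < mobiusLevel m n (i - 1) ∧ mobiusLevel m n i < mobiusLevel m n j)
      ∨ (mobiusLevel m n j < mobiusLevel m n i ∧ mobiusLevel m n (i - 1) < mobiusLevel m n j) := hb
    clear hb
    have hi1 := fin_val_sub_one i
    have hi := i.2
    have hj := j.2
    have hv : (j : ℕ) ≠ i := fun e => hji (Fin.ext e)
    have hv1 : (j : ℕ) ≠ (i - 1 : Fin _) := fun e => hji1 (Fin.ext e)
    have him := Z.interior_face_im_pos hh hzj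
    obtain h1 | h1 | h1 : (i : ℕ) ≤ 2 * m + 2 * n ∨ (i : ℕ) = 2 * m + 2 * n + 1 ∨
      (i : ℕ) = 2 * m + 2 * n + 2 := by omega
    · obtain ⟨y1, y2⟩ := Z.mem_foldLine_of_le h1 hzi
      rw [abs_le] at y2
      rw [mobiusLevel_pred h1, mobiusLevel_of_le h1] at hb'
      by_cases he : Even (i : ℕ)
      · rw [if_pos he] at y1
        linarith
      rw [if_neg he] at y1 hb'
      obtain h2 | h2 | h2 | h2 : (j : ℕ) < 2 * m + 2 * n ∨ (j : ℕ) = 2 * m + 2 * n ∨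
        (j : ℕ) = 2 * m + 2 * n + 1 ∨ (j : ℕ) = 2 * m + 2 * n + 2 := by omega
      · have := Z.interior_face_im_lt h2 hzj
        linarith
      · rw [mobiusLevel_of_le h2.le] at hb'
        simp only [Nat.even_iff] at hb' he
        split_ifs at hb' <;> omega
      · rw [mobiusLevel_E h2] at hb'
        simp only [Nat.even_iff] at hb' he
        split_ifs at hb' <;> omega
      · rw [mobiusLevel_A h2] at hb'
        -- The piece from A has level -1, which lies between the levels of a fold at an odd vertex
        -- only among the half-wraps; these are at least 1/c away along the axis.
        have hi2 : 2 * m ≤ (i : ℕ) := by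
          simp only [Nat.even_iff] at hb' he
          split_ifs at hb' <;> omega
        have := Z.interior_last_face_lt h2 hzj
        have := hle _ hi2
        have : 0 < s / c * z.im := mul_pos hsc him
        linarith [y2.1]
    · rw [if_neg (by omega), h1] at hi1
      rw [mobiusLevel_E h1, mobiusLevel_of_le (i := i - 1) (by omega), hi1] at hb'
      have he : Even (2 * m + 2 * n) := Z.even
      -- The fold at E joins the two lowest levels, which are adjacent.
      rw [show 2 * m + 2 * n + 1 - 1 = 2 * m + 2 * n by omega, if_neg (by omega), if_pos he] at hb'
      omega
    · rw [if_neg (by omega), h1] at hi1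
      rw [mobiusLevel_A h1, mobiusLevel_E (i := i - 1) (by omega)] at hb'
      -- Only the pieces that went to the bottom lie between the levels joined at A, and they all
      -- start beyond the escape accordion.
      have hj2 : 2 * m ≤ (j : ℕ) ∧ (j : ℕ) ≤ 2 * m + 2 * n ∧ Even (j : ℕ) := by
        simp only [mobiusLevel, Nat.even_iff] at hb' ⊢
        split_ifs at hb' <;> omega
      have y1 := Z.mem_foldLine_last hh h1 hzi
      have y2 := Z.lt_interior_even_face hj2.2.1 hj2.2.2 hzj
      have := hle _ hj2.1
      have : 0 < s / c * z.im := mul_pos hsc him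
      linarith [(abs_le.1 y1.2).2]
  · intro i j hij hz _
    obtain ⟨h1, h2, h3⟩ := Z.foldLine_inter hij hz
    have hv : (i : ℕ) ≠ j := fun e => hij (Fin.ext e)
    change (mobiusLevel m n (j - 1) < mobiusLevel m n (i - 1) ∧
        mobiusLevel m n i < mobiusLevel m n (j - 1) ∨
      mobiusLevel m n (j - 1) < mobiusLevel m n i ∧
        mobiusLevel m n (i - 1) < mobiusLevel m n (j - 1)) ↔
      (mobiusLevel m n j < mobiusLevel m n (i - 1) ∧ mobiusLevel m n i < mobiusLevel m n j ∨
      mobiusLevel m n j < mobiusLevel m n i ∧ mobiusLevel m n (i - 1) < mobiusLevel m n j)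
    rw [mobiusLevel_pred h1, mobiusLevel_pred h2, mobiusLevel_of_le h1, mobiusLevel_of_le h2]
    simp only [Nat.even_iff] at h3 ⊢
    -- The level intervals are unit intervals in the accordion and a nested increasing family in the
    -- half-wraps, so no two of them interleave.
    split_ifs <;> omega

/-! ### The ribbonlength of the construction -/

/-- The two terms are the limits of K d (1+s) and of 2h(1+s)/c, as K d tends to 1/(sc) and h to 1/2.
-/
theorem limitRibbonlength_eq {θ : ℝ} (hs : 0 < Real.sin (θ / 2)) (hc : 0 < Real.cos (θ / 2)) :
    limitRibbonlength θ = (1 + Real.sin (θ / 2)) / (Real.sin (θ / 2) * Real.cos (θ / 2)) +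
      (1 + Real.sin (θ / 2)) / Real.cos (θ / 2) := by
  rw [limitRibbonlength, Real.tan_eq_sin_div_cos]
  field_simp
  ring

theorem half_angle_pos {θ : ℝ} (hθ : θ ∈ Set.Ioo 0 Real.pi) :
    0 < Real.sin (θ / 2) ∧ 0 < Real.cos (θ / 2) := by
  obtain ⟨h1, h2⟩ := hθ
  exact ⟨Real.sin_pos_of_pos_of_lt_pi (by linarith) (by linarith),
    Real.cos_pos_of_mem_Ioo ⟨by linarith, by linarith⟩⟩

theorem isZigzag_of_mem {m : ℕ} (n : ℕ) {θ d h : ℝ} (hθ : θ ∈ Set.Ioo 0 Real.pi) (hm : 0 < m)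
    (hd : 0 < d) (hh : 0 < h) :
    IsZigzag (2 * m + 2 * n) (Real.sin (θ / 2)) (Real.cos (θ / 2)) d h where
  even := ⟨m + n, by ring⟩
  two_le := by omega
  s_pos := (half_angle_pos hθ).1
  c_pos := (half_angle_pos hθ).2
  sq := Real.sin_sq_add_cos_sq _
  d_pos := hd
  h_pos := hh

theorem isFoldedRibbonKnot_of_isEscapeAccordion {m n : ℕ} {θ d h : ℝ}
    (hθ : θ ∈ Set.Ioo 0 Real.pi) (ha : IsEscapeAccordion m θ d) (hh : 1 / 2 < h) :
    (mobiusBand m n θ d h).IsFoldedRibbonKnot := by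
  obtain ⟨hm, hd, h1⟩ := ha
  rw [mobiusBand_eq]
  refine mobiusBand_isFoldedRibbonKnot (isZigzag_of_mem n hθ hm hd (by linarith)) hm hh ?_
  rw [div_le_iff₀ (half_angle_pos hθ).2]
  linarith

/-- The escape condition and h > 1/2 bound the two terms of the length separately, and both bounds
can be approached simultaneously. -/
theorem isGLB_constructionLengths (n : ℕ) {θ : ℝ} (hθ : θ ∈ Set.Ioo 0 Real.pi) :
    IsGLB (constructionLengths n θ) (limitRibbonlength θ) := by
  obtain ⟨hs, hc⟩ := half_angle_pos hθ
  rw [limitRibbonlength_eq hs hc]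
  have hsc : 0 < Real.sin (θ / 2) * Real.cos (θ / 2) := mul_pos hs hc
  constructor
  · rintro L ⟨m, d, h, ⟨hm, hd, h1⟩, hh, hk, rfl⟩
    have Z := isZigzag_of_mem n hθ hm hd hh
    rw [mobiusBand_eq] at hk ⊢
    have hh2 := Z.half_lt_of_disjoint hk.foldLine_disjoint
    rw [Z.ribbonlength_eq]
    have hd1 : 1 / (Real.sin (θ / 2) * Real.cos (θ / 2)) ≤ 2 * m * d := by
      rw [div_le_iff₀ hsc]
      linarith
    have hn : 0 ≤ (n : ℝ) * d := by positivity
    have e1 : (1 + Real.sin (θ / 2)) / (Real.sin (θ / 2) * Real.cos (θ / 2)) ≤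
        ((2 * m + 2 * n : ℕ) : ℝ) * d * (1 + Real.sin (θ / 2)) := by
      rw [div_eq_mul_one_div, mul_comm]
      gcongr
      push_cast
      linarith
    have e2 : (1 + Real.sin (θ / 2)) / Real.cos (θ / 2) ≤
        2 * h * ((1 + Real.sin (θ / 2)) / Real.cos (θ / 2)) :=
      le_mul_of_one_le_left (by positivity) (by linarith)
    linarith
  · intro b hb
    refine le_of_forall_pos_le_add fun ε hε => ?_
    set s := Real.sin (θ / 2)
    set c := Real.cos (θ / 2)
    -- With d chosen to make the escape condition an equality, this m bounds the cost n(1+s)/(scm)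
    -- of the half-wraps by ε/2; the excess of h over 1/2 below costs the other ε/2.
    obtain ⟨m, hm⟩ := exists_nat_gt (2 * n * (1 + s) / (ε * (s * c)))
    have hm0 : (0 : ℝ) < m := lt_of_le_of_lt (by positivity) hm
    have hmn : 0 < m := Nat.cast_pos.1 hm0
    have hd : 0 < 1 / (2 * m * (s * c)) := by positivity
    have hδ : 0 < ε * c / (4 * (1 + s)) := by positivity
    have ha : IsEscapeAccordion m θ (1 / (2 * m * (s * c))) := by
      refine ⟨hmn, hd, le_of_eq ?_⟩
      change 1 = 2 * m * (1 / (2 * m * (s * c))) * s * c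
      field_simp
    have hL := hb ⟨m, 1 / (2 * m * (s * c)), 1 / 2 + ε * c / (4 * (1 + s)), ha, by linarith,
      isFoldedRibbonKnot_of_isEscapeAccordion hθ ha (by linarith), rfl⟩
    rw [mobiusBand_eq, (isZigzag_of_mem n hθ hmn hd (by linarith)).ribbonlength_eq] at hL
    refine hL.trans ?_
    change ((2 * m + 2 * n : ℕ) : ℝ) * (1 / (2 * m * (s * c))) * (1 + s) +
      2 * (1 / 2 + ε * c / (4 * (1 + s))) * ((1 + s) / c) ≤ _
    have h1s : 1 + s ≠ 0 := by positivity
    have e : ((2 * m + 2 * n : ℕ) : ℝ) * (1 / (2 * m * (s * c))) * (1 + s) +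
        2 * (1 / 2 + ε * c / (4 * (1 + s))) * ((1 + s) / c) =
        (1 + s) / (s * c) + (1 + s) / c + (n * (1 + s) / (s * c) / m + ε / 2) := by
      push_cast
      field_simp
      ring
    rw [e]
    rw [div_lt_iff₀ (by positivity)] at hm
    have : n * (1 + s) / (s * c) / m ≤ ε / 2 := by
      rw [div_div, div_le_iff₀ (by positivity)]
      linarith
    linarith

theorem limitRibbonlength_pi_div_three : limitRibbonlength (Real.pi / 3) = 3 * Real.sqrt 3 := by
  have h : Real.pi / 3 / 2 = Real.pi / 6 := by ring
  rw [limitRibbonlength, h, Real.tan_eq_sin_div_cos, Real.cos_pi_div_six, Real.sin_pi_div_six]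
  have h3 : Real.sqrt 3 ^ 2 = 3 := Real.sq_sqrt (by norm_num)
  have h0 : Real.sqrt 3 ≠ 0 := by positivity
  field_simp
  rw [h3]
  norm_num

theorem limitRibbonlength_lt {θ : ℝ} (hθ : θ ∈ Set.Ioo 0 Real.pi) (hne : θ ≠ Real.pi / 3) :
    limitRibbonlength (Real.pi / 3) < limitRibbonlength θ := by
  obtain ⟨hs, hc⟩ := half_angle_pos hθ
  have hsin : Real.sin (θ / 2) ≠ 1 / 2 := by
    rw [← Real.sin_pi_div_six]
    intro e
    have := Real.injOn_sin ⟨by linarith [hθ.1, Real.pi_pos], by linarith [hθ.2]⟩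
      ⟨by linarith [Real.pi_pos], by linarith [Real.pi_pos]⟩ e
    exact hne (by linarith)
  rw [limitRibbonlength_pi_div_three, limitRibbonlength_eq hs hc]
  have hsq := Real.sin_sq_add_cos_sq (θ / 2)
  set s := Real.sin (θ / 2)
  set c := Real.cos (θ / 2)
  have hc2 : c ^ 2 = (1 - s) * (1 + s) := by linarith
  have hs1 : 0 < 1 - s := by nlinarith
  have e : (1 + s) / (s * c) + (1 + s) / c = (1 + s) ^ 2 / (s * c) := by
    field_simp
  rw [e, lt_div_iff₀ (by positivity)]
  refine lt_of_pow_lt_pow_left₀ 2 (by positivity) ?_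
  have h3 : Real.sqrt 3 ^ 2 = 3 := Real.sq_sqrt (by norm_num)
  have : (3 * Real.sqrt 3 * (s * c)) ^ 2 = 27 * s ^ 2 * ((1 - s) * (1 + s)) := by
    rw [← hc2]
    linear_combination 9 * s ^ 2 * c ^ 2 * h3
  rw [this]
  -- This product is the difference (1+s)⁴ - 27s²(1-s)(1+s) of the squared sides; its double root s
  -- = 1/2 is θ = π/3.
  have hp : 0 < (2 * s - 1) ^ 2 * (7 * s + 1) * (1 + s) := by
    have : 2 * s - 1 ≠ 0 := fun h => hsin (by linarith)
    positivity
  linear_combination hp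

/-! ### Fold angles and the boundary -/

/-- The fold angle is determined by the norm of the difference of consecutive directions. The
squared norms 4c² and 2(1+s) both equal 3 at s = 1/2, so the folds at E and A have the same angle as
the others. -/
theorem IsZigzag.foldAngle_eq {K : ℕ} {s c d h : ℝ} {covers : Fin (K + 3) → Fin (K + 3) → Prop}
    (Z : IsZigzag K s c d h) (hs : s = 1 / 2) (i : Fin (K + 3)) :
    (zigzagDiagram K s c d h covers).foldAngle i = Real.pi / 3 := by
  have h1 := Z.vertex_sub (covers := covers) (i - 1)
  rw [sub_add_cancel] at h1
  rw [RibbonDiagram.foldAngle, Z.vertex_sub, ← neg_sub, h1, ← mul_neg, ← Complex.real_smul,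
    ← Complex.real_smul, InnerProductGeometry.angle_smul_left_of_pos _ _ (Z.len_pos _),
    InnerProductGeometry.angle_smul_right_of_pos _ _ (Z.len_pos _), InnerProductGeometry.angle,
    norm_neg, Z.norm_dir, Z.norm_dir, inner_neg_left]
  have h2 := norm_sub_sq_real (zigzagDir K s c i) (zigzagDir K s c (i - 1 : Fin (K + 3)))
  rw [Z.dir_sub, Z.norm_dir, Z.norm_dir, ← Complex.normSq_eq_norm_sq, real_inner_comm] at h2
  have h3 : Complex.normSq (if (i : ℕ) ≤ K then (if Even (i : ℕ) then ⟨0, 2 * c⟩ else ⟨0, -(2 * c)⟩)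
      else if (i : ℕ) = K + 1 then ⟨-(1 + s), -c⟩ else ⟨1 + s, -c⟩) = 3 := by
    have hsq := Z.sq
    rw [hs] at hsq ⊢
    split_ifs <;> rw [Complex.normSq_mk] <;> linarith
  rw [h3] at h2
  have h4 : -inner ℝ (zigzagDir K s c (i - 1 : Fin (K + 3))) (zigzagDir K s c i) / (1 * 1) =
      Real.cos (Real.pi / 3) := by
    rw [Real.cos_pi_div_three]
    linarith
  rw [h4, Real.arccos_cos (by positivity) (by linarith [Real.pi_pos])]

namespace RibbonDiagram

/-- The strand advances one edge and changes side at every step. -/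
theorem nextStrand_pow {N : ℕ} [NeZero N] (k : ℕ) :
    (nextStrand N ^ k) (0, true) = (Fin.ofNat N k, decide (Even k)) := by
  induction k with
  | zero => simp
  | succ k ih =>
    rw [pow_succ', Equiv.Perm.mul_apply, ih]
    have h : Fin.ofNat N k + 1 = Fin.ofNat N (k + 1) := by
      apply Fin.ext
      simp [Fin.val_add]
    simp only [nextStrand, Equiv.prodCongr_apply, Prod.map_apply, Equiv.coe_addRight, h,
      Nat.even_add_one, Equiv.boolNot_apply, decide_not]

/-- Edge j is visited after j and after j + N steps; for odd N these have opposite parities, so both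
of its sides are reached. -/
theorem boundaryComponent_eq_univ {N : ℕ} [NeZero N] (hN : Odd N) :
    boundaryComponent N = Finset.univ := by
  refine Finset.eq_univ_of_forall fun ⟨j, b⟩ => ?_
  simp only [boundaryComponent, Finset.mem_filter, Finset.mem_univ, true_and]
  by_cases hb : b = decide (Even (j : ℕ))
  · refine ⟨(j : ℕ), ?_⟩
    rw [zpow_natCast, nextStrand_pow, hb, Fin.ofNat_val_eq_self]
  · refine ⟨((j + N : ℕ) : ℤ), ?_⟩
    rw [zpow_natCast, nextStrand_pow]
    have h : Fin.ofNat N (j + N) = j := by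
      apply Fin.ext
      simp [Nat.mod_eq_of_lt j.2]
    rw [h]
    have : ¬ Even N := Nat.not_even_iff_odd.2 hN
    rw [show decide (Even ((j : ℕ) + N)) = b by
      by_cases hj : Even (j : ℕ) <;> cases b <;> simp only [hj, this, Nat.even_add, decide_true,
        decide_false, Bool.true_eq_false, Bool.false_eq_true, not_true, iff_false,
        iff_self, not_false_iff] at hb ⊢]

theorem isMobius_of_odd {N : ℕ} [NeZero N] (D : RibbonDiagram N) (hN : Odd N) : D.IsMobius := by
  rw [IsMobius, boundaryComponent_eq_univ hN]
  exact Finset.mem_univ _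

end RibbonDiagram

/-! ### The polygon is unknotted -/

section Polyline

variable {V : Type*} [AddCommGroup V] [Module ℝ V]

theorem head_mem_polyline (a : V) (l : List V) : a ∈ polyline (a :: l) := by
  cases l with
  | nil => exact Set.mem_singleton a
  | cons b l => exact Or.inl (left_mem_segment ℝ a b)

theorem last_mem_polyline (l : List V) (a : V) : a ∈ polyline (l ++ [a]) := by
  induction l with
  | nil => exact Set.mem_singleton a
  | cons b l ih =>
    cases l with
    | nil => exact Or.inl (right_mem_segment ℝ b a)
    | cons c l => exact Or.inr ih

end Polyline

namespace IsZigzag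

variable {K : ℕ} {s c d h : ℝ} {covers : Fin (K + 3) → Fin (K + 3) → Prop}

/-- The vertices of a zigzag diagram as points in three-space. -/
def point (K : ℕ) (s c d h : ℝ) (i : ℕ) : ℂ × ℝ := (zigzagVertex K s c d h i, 0)

/-- The list of `r` consecutive vertices from the vertex `k` on, followed by the vertex `0`. -/
def arc (K : ℕ) (s c d h : ℝ) (k r : ℕ) : List (ℂ × ℝ) :=
  (List.range' k r).map (point K s c d h) ++ [point K s c d h 0]

theorem arc_succ (k r : ℕ) :
    arc K s c d h k (r + 1) = point K s c d h k :: arc K s c d h (k + 1) r := by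
  simp [arc, List.range'_succ]

theorem point_zero : point K s c d h 0 = 0 := by
  simp [point, zigzagVertex]
  rfl

theorem point_re_lt (Z : IsZigzag K s c d h) {k : ℕ} (hk : k ≤ K) :
    (point K s c d h k).1.re < (point K s c d h (k + 1)).1.re := by
  have hds : 0 < d * s := mul_pos Z.d_pos Z.s_pos
  have hht : 0 < h * (s / c) := mul_pos Z.h_pos (div_pos Z.s_pos Z.c_pos)
  simp only [point, zigzagVertex, if_pos hk]
  rcases hk.lt_or_eq with h1 | rfl
  · rw [if_pos (show k + 1 ≤ K by omega)]
    push_cast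
    linarith
  · rw [if_neg (by omega), if_pos rfl]
    simp only
    linarith

theorem point_re_nonneg (Z : IsZigzag K s c d h) {k : ℕ} (hk : k ≤ K) :
    0 ≤ (point K s c d h k).1.re := by
  have hds : 0 < d * s := mul_pos Z.d_pos Z.s_pos
  simp only [point, zigzagVertex, if_pos hk]
  positivity

theorem point_im_mem (Z : IsZigzag K s c d h) {k : ℕ} (hk : k ≤ K) :
    0 ≤ (point K s c d h k).1.im ∧ (point K s c d h k).1.im ≤ d * c := by
  have hdc : 0 < d * c := mul_pos Z.d_pos Z.c_pos
  simp only [point, zigzagVertex, if_pos hk]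
  split_ifs
  · exact ⟨le_rfl, hdc.le⟩
  · exact ⟨hdc.le, le_rfl⟩

theorem point_E : point K s c d h (K + 1) = (⟨K * (d * s) + h * (s / c), h⟩, 0) := by
  simp [point, zigzagVertex]

theorem point_A : point K s c d h (K + 2) = (⟨-(h * (s / c)), h⟩, 0) := by
  simp [point, zigzagVertex]

theorem mem_segment_point {a b x : ℂ × ℝ} (hx : x ∈ segment ℝ a b) :
    ∃ u : ℝ, 0 ≤ u ∧ u ≤ 1 ∧ x = (1 - u) • a + u • b := by
  obtain ⟨p, u, hp, hu, hpu, rfl⟩ := hx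
  exact ⟨u, hu, by linarith, by rw [← hpu, add_sub_cancel_right]⟩

theorem polyline_last (Z : IsZigzag K s c d h) {x : ℂ × ℝ}
    (hx : x ∈ polyline (arc K s c d h (K + 2) 1)) :
    x = point K s c d h 0 ∨ x.1.re < 0 := by
  have hht : 0 < h * (s / c) := mul_pos Z.h_pos (div_pos Z.s_pos Z.c_pos)
  simp only [arc, List.range'_one, List.map_cons, List.map_nil, List.cons_append,
    List.nil_append, polyline, Set.mem_union, Set.mem_singleton_iff] at hx
  rcases hx with hx | hx
  · obtain ⟨u, h0, h1, rfl⟩ := mem_segment_point hx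
    rcases h1.eq_or_lt with rfl | h1
    · left
      simp
    · right
      rw [point_zero, point_A]
      simp
      nlinarith
  · exact Or.inl hx

theorem polyline_E (Z : IsZigzag K s c d h) {x : ℂ × ℝ}
    (hx : x ∈ polyline (arc K s c d h (K + 1) 2)) :
    x = point K s c d h 0 ∨ x.1.re < 0 ∨ x.1.im = h := by
  rw [arc_succ, arc_succ, polyline, Set.mem_union, ← arc_succ] at hx
  rcases hx with hx | hx
  · obtain ⟨u, h0, h1, rfl⟩ := mem_segment_point hx
    right
    right
    rw [point_A, point_E]
    simp
    ring
  · rcases Z.polyline_last hx with hx | hx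
    · exact Or.inl hx
    · exact Or.inr (Or.inl hx)

/-- Abscissae increase along the zigzag and on to E, so the path ahead of vertex k lies strictly to
its right until the edges EA and A0, which the last three alternatives cover. -/
theorem polyline_zigzag (Z : IsZigzag K s c d h) (j k : ℕ) (hjk : j + k = K) {x : ℂ × ℝ}
    (hx : x ∈ polyline (arc K s c d h k (j + 3))) :
    x = point K s c d h k ∨ (point K s c d h k).1.re < x.1.re ∨ x = point K s c d h 0 ∨
      x.1.re < 0 ∨ x.1.im = h := by
  induction j generalizing k with
  | zero =>
    obtain rfl : k = K := by omega
    rw [arc_succ, arc_succ, polyline, Set.mem_union, ← arc_succ] at hx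
    rcases hx with hx | hx
    · obtain ⟨u, h0, h1, rfl⟩ := mem_segment_point hx
      rcases h0.eq_or_lt with rfl | h0
      · left
        simp
      · right
        left
        have := Z.point_re_lt le_rfl
        simp
        nlinarith
    · exact Or.inr (Or.inr (Z.polyline_E hx))
  | succ j ih =>
    have hlt := Z.point_re_lt (show k ≤ K by omega)
    rw [show j + 1 + 3 = j + 2 + 1 + 1 by ring, arc_succ, arc_succ, polyline, Set.mem_union,
      ← arc_succ] at hx
    rcases hx with hx | hx
    · obtain ⟨u, h0, h1, rfl⟩ := mem_segment_point hx
      rcases h0.eq_or_lt with rfl | h0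
      · left
        simp
      · right
        left
        simp
        nlinarith
    · rcases ih (k + 1) (by omega) hx with rfl | hx | hx
      · exact Or.inr (Or.inl hlt)
      · exact Or.inr (Or.inl (hlt.trans hx))
      · exact Or.inr (Or.inr hx)

/-- The triangle lies over the axis between 0 and the abscissa of vertex k + 1; for k < K it is also
below height h, and for k = K it reaches that height only at E. For k = 0 it degenerates to the
first edge, so simplicity of the polygon follows from the same statement. -/
theorem triangle_inter (Z : IsZigzag K s c d h) (hh : d * c < h) (j k : ℕ) (hjk : j + k = K) :
    convexHull ℝ {point K s c d h 0, point K s c d h k, point K s c d h (k + 1)} ∩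
      polyline (arc K s c d h (k + 1) (j + 2)) = {point K s c d h 0, point K s c d h (k + 1)} := by
  apply Set.Subset.antisymm
  · rintro x ⟨hx, hx'⟩
    rw [convexHull_insert (Set.insert_nonempty _ _), convexHull_pair, mem_convexJoin] at hx
    obtain ⟨a, ha, y, hy, hx⟩ := hx
    rw [Set.mem_singleton_iff] at ha
    subst ha
    obtain ⟨u, hu0, hu1, rfl⟩ := mem_segment_point hy
    obtain ⟨v, hv0, hv1, rfl⟩ := mem_segment_point hx
    have hk0 := Z.point_re_nonneg (show k ≤ K by omega)
    have hkk := Z.point_re_lt (show k ≤ K by omega)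
    set a := (point K s c d h k).1.re
    set b := (point K s c d h (k + 1)).1.re
    have h1u : 0 ≤ 1 - u := by linarith
    have hre : ((1 - v) • point K s c d h 0 +
        v • ((1 - u) • point K s c d h k + u • point K s c d h (k + 1))).1.re =
        v * ((1 - u) * a + u * b) := by
      rw [point_zero]
      simp [a, b]
      ring
    have hre0 : 0 ≤ (1 - u) * a + u * b :=
      add_nonneg (mul_nonneg h1u hk0) (mul_nonneg hu0 (hk0.trans hkk.le))
    have hreb : (1 - u) * a + u * b ≤ b := by nlinarith
    have him : ((1 - v) • point K s c d h 0 +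
        v • ((1 - u) • point K s c d h k + u • point K s c d h (k + 1))).1.im =
        v * ((1 - u) * (point K s c d h k).1.im + u * (point K s c d h (k + 1)).1.im) := by
      rw [point_zero]
      simp
      ring
    have hi1 := Z.point_im_mem (show k ≤ K by omega)
    rw [Set.mem_insert_iff, Set.mem_singleton_iff]
    rcases Nat.eq_zero_or_pos j with rfl | hj
    · obtain rfl : k = K := by omega
      rcases Z.polyline_E hx' with e | e | e
      · exact Or.inl e
      · rw [hre] at e
        exact absurd e (not_lt.2 (mul_nonneg hv0 hre0))
      · right
        have hK0 : (point k s c d h k).1.im = 0 := by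
          simp [point, zigzagVertex, Z.even]
        rw [him, hK0, point_E] at e
        have huv : v * u = 1 := by
          have := Z.h_pos.ne'
          apply mul_right_cancel₀ this
          linear_combination e
        have : u = 1 := by nlinarith
        have : v = 1 := by nlinarith
        subst u v
        simp
    · obtain ⟨j, rfl⟩ := Nat.exists_eq_succ_of_ne_zero hj.ne'
      have hi2 := Z.point_im_mem (show k + 1 ≤ K by omega)
      rcases Z.polyline_zigzag j (k + 1) (by omega) hx' with e | e | e | e | e
      · exact Or.inr e
      · rw [hre] at e
        have : v * ((1 - u) * a + u * b) ≤ (1 - u) * a + u * b := mul_le_of_le_one_left hre0 hv1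
        exact absurd e (not_lt.2 (this.trans hreb))
      · exact Or.inl e
      · rw [hre] at e
        exact absurd e (not_lt.2 (mul_nonneg hv0 hre0))
      · rw [him] at e
        have h2 : 0 ≤ (1 - u) * (point K s c d h k).1.im + u * (point K s c d h (k + 1)).1.im :=
          add_nonneg (mul_nonneg h1u hi1.1) (mul_nonneg hu0 hi2.1)
        have h3 : (1 - u) * (point K s c d h k).1.im + u * (point K s c d h (k + 1)).1.im ≤ d * c := by
          nlinarith [mul_le_mul_of_nonneg_left hi1.2 h1u, mul_le_mul_of_nonneg_left hi2.2 hu0]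
        have := mul_le_of_le_one_left h2 hv1
        linarith
  · rintro x (rfl | rfl)
    · exact ⟨subset_convexHull ℝ _ (by simp), last_mem_polyline _ _⟩
    · refine ⟨subset_convexHull ℝ _ (by simp), ?_⟩
      rw [arc_succ]
      exact head_mem_polyline _ _

/-- The edge from k to k + 1 is a side of the triangle with apex 0, so it meets the path ahead at
most in vertices 0 and k + 1; the former is excluded by the positive abscissae when k ≥ 1. -/
theorem isSimpleArc_arc (Z : IsZigzag K s c d h) (hh : d * c < h) (j k : ℕ) (hjk : j + k = K + 1)
    (hk : 1 ≤ k) : IsSimpleArc (arc K s c d h k (j + 2)) := by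
  induction j generalizing k with
  | zero =>
    obtain rfl : k = K + 1 := by omega
    have hht : 0 < h * (s / c) := mul_pos Z.h_pos (div_pos Z.s_pos Z.c_pos)
    have hds : 0 < d * s := mul_pos Z.d_pos Z.s_pos
    have hKds : 0 ≤ K * (d * s) := by positivity
    have hh0 := Z.h_pos
    have hA : point K s c d h (K + 2) ≠ point K s c d h 0 := fun e => by
      have := congrArg (fun x : ℂ × ℝ => x.1.im) e
      rw [point_A, point_zero] at this
      exact hh0.ne' this
    have hlast : polyline [point K s c d h (K + 2), point K s c d h 0] =
        segment ℝ (point K s c d h (K + 2)) (point K s c d h 0) := by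
      rw [polyline, polyline, Set.union_eq_left, Set.singleton_subset_iff]
      exact right_mem_segment ℝ _ _
    change point K s c d h (K + 1) ≠ point K s c d h (K + 2) ∧
      segment ℝ (point K s c d h (K + 1)) (point K s c d h (K + 2)) ∩
        polyline [point K s c d h (K + 2), point K s c d h 0] = {point K s c d h (K + 2)} ∧
      point K s c d h (K + 2) ≠ point K s c d h 0 ∧
      segment ℝ (point K s c d h (K + 2)) (point K s c d h 0) ∩ {point K s c d h 0} =
        {point K s c d h 0} ∧ True
    refine ⟨fun e => ?_, ?_, hA, ?_, trivial⟩
    · have := congrArg (fun x : ℂ × ℝ => x.1.re) e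
      rw [point_A, point_E] at this
      simp only at this
      linarith
    · rw [hlast]
      apply Set.Subset.antisymm
      · rintro x ⟨hx, hx'⟩
        obtain ⟨u, h0, h1, rfl⟩ := mem_segment_point hx
        obtain ⟨v, hv0, hv1, e⟩ := mem_segment_point hx'
        have e' := congrArg (fun x : ℂ × ℝ => x.1.im) e
        rw [point_A, point_E, point_zero] at e'
        simp at e'
        have hv : v = 0 := by
          apply mul_right_cancel₀ hh0.ne'
          linear_combination e'
        rw [e, hv]
        simp
      · rintro x rfl
        exact ⟨right_mem_segment ℝ _ _, left_mem_segment ℝ _ _⟩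
    · rw [Set.inter_eq_right, Set.singleton_subset_iff]
      exact right_mem_segment ℝ _ _
  | succ j ih =>
    have hkk := Z.point_re_lt (show k ≤ K by omega)
    have hT := Z.triangle_inter hh j k (by omega)
    have hr := ih (k + 1) (by omega) (by omega)
    have hpos : 0 < (point K s c d h k).1.re := by
      have hds : 0 < d * s := mul_pos Z.d_pos Z.s_pos
      simp only [point, zigzagVertex, if_pos (show k ≤ K by omega)]
      have : (0 : ℝ) < k := by exact_mod_cast hk
      positivity
    rw [show j + 1 + 2 = j + 1 + 1 + 1 by ring, arc_succ, arc_succ, IsSimpleArc, ← arc_succ]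
    refine ⟨fun e => hkk.ne (by rw [e]), ?_, hr⟩
    apply Set.Subset.antisymm
    · rintro x ⟨hx, hx'⟩
      have hx2 : x ∈ convexHull ℝ {point K s c d h 0, point K s c d h k,
          point K s c d h (k + 1)} :=
        segment_subset_convexHull (by simp) (by simp) hx
      have hx3 := hT.subset ⟨hx2, hx'⟩
      rw [Set.mem_insert_iff] at hx3
      rcases hx3 with rfl | hx3
      · exfalso
        obtain ⟨u, h0, h1, e⟩ := mem_segment_point hx
        have := congrArg (fun x : ℂ × ℝ => x.1.re) e
        rw [point_zero] at this
        simp at this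
        nlinarith
      · exact hx3
    · rintro x rfl
      refine ⟨right_mem_segment ℝ _ _, ?_⟩
      rw [arc_succ]
      exact head_mem_polyline _ _

/-- The closed polygon through the vertex `0` and the vertices from `k` on. -/
theorem isSimpleClosedPolygon (Z : IsZigzag K s c d h) (hh : d * c < h) (j k : ℕ)
    (hjk : j + k = K) : IsSimpleClosedPolygon (point K s c d h 0 :: point K s c d h (k + 1) ::
      (List.range' (k + 2) (j + 1)).map (point K s c d h)) := by
  have hT := Z.triangle_inter hh j k hjk
  have ha := Z.isSimpleArc_arc hh j (k + 1) (by omega) (by omega)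
  rw [show j + 2 = j + 1 + 1 by ring, arc_succ] at hT ha
  refine ⟨?_, ha⟩
  apply Set.Subset.antisymm
  · rintro x ⟨hx, hx'⟩
    exact hT.subset ⟨segment_subset_convexHull (by simp) (by simp) hx, hx'⟩
  · rintro x (rfl | rfl)
    · exact ⟨left_mem_segment ℝ _ _, (hT.superset (by simp)).2⟩
    · exact ⟨right_mem_segment ℝ _ _, (hT.superset (by simp)).2⟩

/-- Each inverse triangle move cuts off the vertex next to the apex 0. -/
theorem eqvGen_triangle (Z : IsZigzag K s c d h) (hh : d * c < h) (j k : ℕ) (hjk : j + k = K) :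
    Relation.EqvGen TriangleMove (point K s c d h 0 :: point K s c d h (k + 1) ::
      (List.range' (k + 2) (j + 1)).map (point K s c d h))
      [point K s c d h 0, point K s c d h (K + 1), point K s c d h (K + 2)] := by
  induction j generalizing k with
  | zero =>
    obtain rfl : k = K := by omega
    exact Relation.EqvGen.refl _
  | succ j ih =>
    refine Relation.EqvGen.trans _ _ _ (Relation.EqvGen.symm _ _ (Relation.EqvGen.rel _ _ ?_))
      (ih (k + 1) (by omega))
    have h1 := Z.isSimpleClosedPolygon hh j (k + 1) (by omega)
    have h2 := Z.isSimpleClosedPolygon hh (j + 1) k hjk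
    have h3 := Z.triangle_inter hh j (k + 1) (by omega)
    rw [List.range'_succ, List.map_cons] at h2 ⊢
    rw [show j + 2 = j + 1 + 1 by ring, arc_succ] at h3
    exact TriangleMove.triangle _ _ _ _ h1 h2 h3

/-- The plane polygon has no crossings, so the lift at constant height 0 is already admissible. -/
theorem isUnknot (Z : IsZigzag K s c d h) (hh : d * c < h) :
    (zigzagDiagram K s c d h covers).IsUnknot := by
  have hpl : ∀ l : List (ℂ × ℝ), (∀ x ∈ l, x.2 = 0) → ∀ x ∈ polyline l, x.2 = 0 := by
    intro l
    induction l with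
    | nil => exact fun _ x hx => absurd hx (Set.notMem_empty x)
    | cons a l ih =>
      intro hl
      cases l with
      | nil =>
        rintro x rfl
        exact hl x (by simp)
      | cons b l =>
        rintro x (hx | hx)
        · obtain ⟨u, -, -, rfl⟩ := mem_segment_point hx
          simp [hl a (by simp), hl b (by simp)]
        · exact ih (fun y hy => hl y (List.mem_cons_of_mem _ hy)) x hx
  refine ⟨fun _ => 0, fun _ => [], fun i => by simp, ?_, ?_⟩
  · intro i j _ _ x hx y hy hxy hne
    refine absurd (Prod.ext hxy ?_) hne
    rw [hpl _ (by simp [RibbonDiagram.liftedEdge]) x hx,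
      hpl _ (by simp [RibbonDiagram.liftedEdge]) y hy]
  · have e : ((List.finRange (K + 3)).flatMap fun i =>
        ((zigzagDiagram K s c d h covers).liftedEdge (fun _ => 0) (fun _ => []) i).dropLast) =
        point K s c d h 0 :: point K s c d h 1 ::
          (List.range' 2 (K + 1)).map (point K s c d h) := by
      have h1 : ((List.finRange (K + 3)).flatMap fun i =>
          ((zigzagDiagram K s c d h covers).liftedEdge (fun _ => 0) (fun _ => []) i).dropLast) =
          (List.finRange (K + 3)).map fun i : Fin (K + 3) => point K s c d h i := by
        rw [List.map_eq_flatMap]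
        rfl
      have h2 : (List.finRange (K + 3)).map (fun i : Fin (K + 3) => point K s c d h i) =
          ((List.finRange (K + 3)).map Fin.val).map (point K s c d h) := by
        rw [List.map_map]
        rfl
      rw [h1, h2, List.map_coe_finRange_eq_range, List.range_eq_range', List.range'_succ,
        List.range'_succ]
      rfl
    rw [e]
    exact ⟨Z.isSimpleClosedPolygon hh K 0 rfl, _, _, _, Z.isSimpleClosedPolygon hh 0 K (by omega),
      Z.eqvGen_triangle hh K 0 rfl⟩

end IsZigzag

/-! ### The ribbon linking number -/

/-- The edge `i` and its boundary strands are, in the coordinates `x / (d s)` and `y / (d c)`, on lines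
of slope `lineSlope K i`; the edge meets the first axis in `lineBase K i`. -/
def lineSlope (K i : ℕ) : ℤ := if i ≤ K ∧ Even i then 1 else -1

/-- The sign of a side of an edge. -/
def sideInt (b : Bool) : ℤ := if b then 1 else -1

/-- The point in which the line through the edge `i` meets the first axis. -/
def lineBase (K i : ℕ) : ℤ := if i ≤ K then (if Even i then (i : ℤ) else i + 1) else 0

/-- The height over the first axis at which the strand `σ` of the edge `i` starts. -/
def startHeight (K : ℕ) (c d h : ℝ) (i : ℕ) (σ : ℝ) : ℝ :=
  if i ≤ K then (if Even i then 0 else 1) else h / (d * c) + σ * (1 / (2 * (d * c)))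

/-- The height over the first axis at which the strand `σ` of the edge `i` ends. -/
def endHeight (K : ℕ) (c d h : ℝ) (i : ℕ) (σ : ℝ) : ℝ :=
  if i < K then (if Even i then 1 else 0)
  else if i = K then h / (d * c) + σ * (1 / (2 * (d * c))) else 0

/-- The point at height `u` on the line parallel to the edge `i`. -/
def linePoint (K m : ℕ) (s c d : ℝ) (i : ℕ) (σ u : ℝ) : ℂ :=
  ⟨d * s * (lineBase K i - lineSlope K i * σ * m), 0⟩ + u • (⟨d * s * lineSlope K i, d * c⟩ : ℂ)

/-- The edge `i` crosses the boundary strand on side `σ` of edge `j`. -/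
def Crosses (K m i j : ℕ) (σ : ℤ) : Prop :=
  lineSlope K j = -lineSlope K i ∧ lineSlope K i * (lineBase K j - lineBase K i) + σ * m = 1

theorem linePoint_re (K m : ℕ) (s c d : ℝ) (i : ℕ) (σ u : ℝ) :
    (linePoint K m s c d i σ u).re =
      d * s * (lineBase K i - lineSlope K i * σ * m + lineSlope K i * u) := by
  simp [linePoint]
  ring

theorem linePoint_im (K m : ℕ) (s c d : ℝ) (i : ℕ) (σ u : ℝ) :
    (linePoint K m s c d i σ u).im = d * c * u := by
  simp [linePoint]
  ring

theorem lineSlope_cases (K i : ℕ) : lineSlope K i = 1 ∨ lineSlope K i = -1 := by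
  unfold lineSlope
  split_ifs
  · exact Or.inl rfl
  · exact Or.inr rfl

theorem even_lineBase (K i : ℕ) : Even (lineBase K i) := by
  unfold lineBase
  split_ifs with h1 h2
  · exact_mod_cast h2
  · have : Even (i + 1) := by rwa [Nat.even_add_one]
    exact_mod_cast this
  · exact Even.zero

theorem lineSlope_K {K : ℕ} (hK : Even K) : lineSlope K K = 1 := by
  simp [lineSlope, hK]

theorem lineSlope_A (K : ℕ) : lineSlope K (K + 2) = -1 := by
  simp [lineSlope]

theorem lineBase_K {K : ℕ} (hK : Even K) : lineBase K K = K := by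
  simp [lineBase, hK]

theorem lineBase_A (K : ℕ) : lineBase K (K + 2) = 0 := by
  simp [lineBase]

/-! ### Oblique edges and strands in lattice coordinates. -/

namespace IsZigzag

variable {K m : ℕ} {s c d h : ℝ} {covers : Fin (K + 3) → Fin (K + 3) → Prop}

theorem zigzagDir_eq {i : ℕ} (hi : i ≠ K + 1) : zigzagDir K s c i = ⟨s, lineSlope K i * c⟩ := by
  rw [zigzagDir, if_neg hi, lineSlope]
  split_ifs <;> simp

/-- The equation `hm` says that half a fold line of the zigzag, of length 1/(2c), is exactly m
horizontal lattice units d s. Taking σ = 0 gives the edge itself, σ = ±1 its two boundary strands.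
-/
theorem start_eq_linePoint (Z : IsZigzag K s c d h) (hm : 2 * m * (d * s * c) = 1)
    {i : Fin (K + 3)} (hi : (i : ℕ) ≠ K + 1) (σ : ℝ) :
    (zigzagDiagram K s c d h covers).vertex i + σ * (zigzagDiagram K s c d h covers).foldVec i =
      linePoint K m s c d i σ (startHeight K c d h i σ) := by
  have hc := Z.c_pos.ne'
  have hd := Z.d_pos.ne'
  have e : 1 / (2 * c) = d * s * m := by
    field_simp
    linarith
  rw [Z.foldVec_eq]
  apply Complex.ext
  · rw [linePoint_re, Complex.add_re, Complex.re_ofReal_mul]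
    rcases index_cases i.2 with ⟨h1, h2⟩ | ⟨h1, h2⟩ | h1 | h1 | h1
    · simp only [vertex_eq_of_le h1.le, zigzagFold, lineBase, lineSlope, startHeight, h1.le, h2,
        if_true, and_true, e]
      push_cast
      ring
    · simp only [vertex_eq_of_le h1.le, zigzagFold, lineBase, lineSlope, startHeight, h1.le, h2,
        if_true, if_false, and_false, e]
      push_cast
      ring
    · simp only [vertex_eq_of_le h1.le, zigzagFold, lineBase, lineSlope, startHeight, h1, le_refl,
        Z.even, if_true, and_true, e]
      push_cast
      ring
    · exact absurd h1 hi
    · rw [vertex_eq_of_eq' h1, fold_eq_of_eq' h1, h1, lineBase_A, lineSlope_A, startHeight,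
        if_neg (by omega), Z.div_one_add]
      push_cast
      field_simp
      linear_combination (-(σ * 1) * hm)
  · rw [linePoint_im, Complex.add_im, Complex.im_ofReal_mul]
    rcases Nat.lt_or_ge K i with h1 | h1
    · have h1 : (i : ℕ) = K + 2 := by omega
      rw [vertex_eq_of_eq' h1, fold_eq_of_eq' h1, h1, startHeight, if_neg (by omega)]
      field_simp
    · rw [fold_im_of_le h1, vertex_eq_of_le h1, startHeight, if_pos h1]
      split_ifs <;> simp

theorem end_eq_linePoint (Z : IsZigzag K s c d h) (hm : 2 * m * (d * s * c) = 1)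
    {i : Fin (K + 3)} (hi : (i : ℕ) ≠ K + 1) (σ : ℝ) :
    (zigzagDiagram K s c d h covers).vertex (i + 1) -
      σ * (zigzagDiagram K s c d h covers).foldVec (i + 1) =
      linePoint K m s c d i σ (endHeight K c d h i σ) := by
  have hc := Z.c_pos.ne'
  have hd := Z.d_pos.ne'
  have e : 1 / (2 * c) = d * s * m := by
    field_simp
    linarith
  have hi1 := fin_val_add_one i
  rw [Z.foldVec_eq]
  rcases index_cases i.2 with ⟨h1, h2⟩ | ⟨h1, h2⟩ | h1 | h1 | h1
  · rw [if_neg (by omega)] at hi1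
    have h3 : ¬ Even ((i : ℕ) + 1) := by rwa [Nat.even_add_one, not_not]
    apply Complex.ext
    · rw [linePoint_re, Complex.sub_re, Complex.re_ofReal_mul, vertex_eq_of_le (by omega)]
      simp only [hi1, zigzagFold, lineBase, lineSlope, endHeight, h1, h1.le, h2, h3,
        show (i : ℕ) + 1 ≤ K by omega, if_true, if_false, and_true, e]
      push_cast
      ring
    · rw [linePoint_im, Complex.sub_im, Complex.im_ofReal_mul, vertex_eq_of_le (by omega),
        fold_im_of_le (by omega), endHeight, if_pos h1, if_pos h2, hi1, if_neg h3]
      ring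
  · rw [if_neg (by omega)] at hi1
    have h3 : Even ((i : ℕ) + 1) := by rwa [Nat.even_add_one]
    apply Complex.ext
    · rw [linePoint_re, Complex.sub_re, Complex.re_ofReal_mul, vertex_eq_of_le (by omega)]
      simp only [hi1, zigzagFold, lineBase, lineSlope, endHeight, h1, h1.le, h2, h3,
        show (i : ℕ) + 1 ≤ K by omega, if_true, if_false, and_false, e]
      push_cast
      ring
    · rw [linePoint_im, Complex.sub_im, Complex.im_ofReal_mul, vertex_eq_of_le (by omega),
        fold_im_of_le (by omega), endHeight, if_pos h1, if_neg h2, hi1, if_pos h3]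
      ring
  · rw [if_neg (by omega), h1] at hi1
    rw [vertex_eq_of_eq hi1, fold_eq_of_eq hi1, Z.div_one_add, endHeight, if_neg (by omega),
      if_pos h1]
    apply Complex.ext
    · rw [linePoint_re, Complex.sub_re, Complex.re_ofReal_mul, h1, lineBase_K Z.even,
        lineSlope_K Z.even]
      push_cast
      field_simp
      linear_combination (σ * 1) * hm
    · rw [linePoint_im, Complex.sub_im, Complex.im_ofReal_mul]
      field_simp
      ring
  · exact absurd h1 hi
  · rw [if_pos h1] at hi1
    have h0 : ((i + 1 : Fin (K + 3)) : ℕ) ≤ K := by omega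
    have e0 : endHeight K c d h i σ = 0 := by
      rw [endHeight, if_neg (by omega), if_neg (by omega)]
    rw [vertex_eq_of_le h0, e0]
    apply Complex.ext
    · rw [linePoint_re, Complex.sub_re, Complex.re_ofReal_mul, h1, lineBase_A, lineSlope_A]
      simp only [hi1, zigzagFold, Nat.zero_le, Even.zero, if_true, e]
      push_cast
      ring
    · rw [linePoint_im, Complex.sub_im, Complex.im_ofReal_mul, fold_im_of_le h0]
      simp [hi1]

/-- The edges K and K + 2 run on to the folds at E and A; there the strand σ ends, respectively
starts, at height h + σ/2. -/
theorem height_mem (Z : IsZigzag K s c d h) {i : ℕ} (hi3 : i < K + 3) (hi : i ≠ K + 1) {σ u : ℝ}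
    (hh : d * c < h + σ * (1 / 2))
    (hu : u ∈ Set.uIcc (startHeight K c d h i σ) (endHeight K c d h i σ)) :
    0 ≤ u ∧ (i < K → u ≤ 1) ∧ (K ≤ i → d * c * u ≤ h + σ * (1 / 2)) := by
  have hdc : 0 < d * c := mul_pos Z.d_pos Z.c_pos
  have e : h / (d * c) + σ * (1 / (2 * (d * c))) = (h + σ * (1 / 2)) / (d * c) := by
    field_simp
  have hpos : 0 ≤ (h + σ * (1 / 2)) / (d * c) := div_nonneg (hdc.le.trans hh.le) hdc.le
  rcases index_cases hi3 with ⟨h1, h2⟩ | ⟨h1, h2⟩ | h1 | h1 | h1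
  · rw [startHeight, endHeight, if_pos h1.le, if_pos h1, if_pos h2, if_pos h2,
      Set.uIcc_of_le zero_le_one] at hu
    exact ⟨hu.1, fun _ => hu.2, fun h => by omega⟩
  · rw [startHeight, endHeight, if_pos h1.le, if_pos h1, if_neg h2, if_neg h2,
      Set.uIcc_of_ge zero_le_one] at hu
    exact ⟨hu.1, fun _ => hu.2, fun h => by omega⟩
  · rw [startHeight, endHeight, if_pos h1.le, if_neg (show ¬ i < K by omega), if_pos h1, h1,
      if_pos Z.even, e, Set.uIcc_of_le hpos] at hu
    refine ⟨hu.1, fun h => by omega, fun _ => ?_⟩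
    have := hu.2
    rwa [le_div_iff₀' hdc] at this
  · exact absurd h1 hi
  · rw [startHeight, endHeight, if_neg (show ¬ i ≤ K by omega), if_neg (show ¬ i < K by omega),
      if_neg (show i ≠ K by omega), e, Set.uIcc_of_ge hpos] at hu
    refine ⟨hu.1, fun h => by omega, fun _ => ?_⟩
    have := hu.2
    rwa [le_div_iff₀' hdc] at this

theorem height_between (Z : IsZigzag K s c d h) {i : ℕ} (hi3 : i < K + 3) (hi : i ≠ K + 1)
    {σ u : ℝ} (hu : 0 < u) (hu1 : i < K → u < 1) (huK : K ≤ i → d * c * u < h + σ * (1 / 2)) :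
    startHeight K c d h i σ < u ∧ u < endHeight K c d h i σ ∨
      endHeight K c d h i σ < u ∧ u < startHeight K c d h i σ := by
  have hdc : 0 < d * c := mul_pos Z.d_pos Z.c_pos
  have e : h / (d * c) + σ * (1 / (2 * (d * c))) = (h + σ * (1 / 2)) / (d * c) := by
    field_simp
  rcases index_cases hi3 with ⟨h1, h2⟩ | ⟨h1, h2⟩ | h1 | h1 | h1
  · rw [startHeight, endHeight, if_pos h1.le, if_pos h1, if_pos h2, if_pos h2]
    exact Or.inl ⟨hu, hu1 h1⟩
  · rw [startHeight, endHeight, if_pos h1.le, if_pos h1, if_neg h2, if_neg h2]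
    exact Or.inr ⟨hu, hu1 h1⟩
  · rw [startHeight, endHeight, if_pos h1.le, if_neg (show ¬ i < K by omega), if_pos h1, h1,
      if_pos Z.even, e]
    refine Or.inl ⟨hu, ?_⟩
    rw [lt_div_iff₀' hdc]
    exact huK h1.ge
  · exact absurd h1 hi
  · rw [startHeight, endHeight, if_neg (show ¬ i ≤ K by omega), if_neg (show ¬ i < K by omega),
      if_neg (show i ≠ K by omega), e]
    refine Or.inr ⟨hu, ?_⟩
    rw [lt_div_iff₀' hdc]
    exact huK (by omega)

theorem edge_eq_image (Z : IsZigzag K s c d h) (hm : 2 * m * (d * s * c) = 1)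
    {i : Fin (K + 3)} (hi : (i : ℕ) ≠ K + 1) :
    segment ℝ ((zigzagDiagram K s c d h covers).vertex i)
      ((zigzagDiagram K s c d h covers).vertex (i + 1)) =
      linePoint K m s c d i 0 '' Set.uIcc (startHeight K c d h i 0) (endHeight K c d h i 0) := by
  have e1 := Z.start_eq_linePoint (covers := covers) hm hi 0
  have e2 := Z.end_eq_linePoint (covers := covers) hm hi 0
  rw [Complex.ofReal_zero, zero_mul, add_zero] at e1
  rw [Complex.ofReal_zero, zero_mul, sub_zero] at e2
  rw [e1, e2]
  exact segment_add_smul _ _ _ _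

theorem sideSign_eq (b : Bool) :
    RibbonDiagram.sideSign b = ((sideInt b : ℝ) : ℂ) := by
  cases b <;> simp [RibbonDiagram.sideSign, sideInt]

theorem strandStart_eq (Z : IsZigzag K s c d h) (hm : 2 * m * (d * s * c) = 1)
    {i : Fin (K + 3)} (hi : (i : ℕ) ≠ K + 1) (b : Bool) :
    (zigzagDiagram K s c d h covers).strandStart (i, b) =
      linePoint K m s c d i (sideInt b : ℝ)
        (startHeight K c d h i (sideInt b : ℝ)) := by
  rw [← Z.start_eq_linePoint (covers := covers) hm hi, ← sideSign_eq]
  rfl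

theorem strandEnd_eq (Z : IsZigzag K s c d h) (hm : 2 * m * (d * s * c) = 1)
    {i : Fin (K + 3)} (hi : (i : ℕ) ≠ K + 1) (b : Bool) :
    (zigzagDiagram K s c d h covers).strandEnd (i, b) =
      linePoint K m s c d i (sideInt b : ℝ)
        (endHeight K c d h i (sideInt b : ℝ)) := by
  rw [← Z.end_eq_linePoint (covers := covers) hm hi, ← sideSign_eq]
  rfl

theorem strand_eq_image (Z : IsZigzag K s c d h) (hm : 2 * m * (d * s * c) = 1)
    {i : Fin (K + 3)} (hi : (i : ℕ) ≠ K + 1) (b : Bool) :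
    segment ℝ ((zigzagDiagram K s c d h covers).strandStart (i, b))
      ((zigzagDiagram K s c d h covers).strandEnd (i, b)) =
      linePoint K m s c d i (sideInt b : ℝ) ''
        Set.uIcc (startHeight K c d h i (sideInt b : ℝ))
          (endHeight K c d h i (sideInt b : ℝ)) := by
  rw [Z.strandStart_eq hm hi, Z.strandEnd_eq hm hi]
  exact segment_add_smul _ _ _ _

theorem mem_openEdge (Z : IsZigzag K s c d h) (hm : 2 * m * (d * s * c) = 1)
    {i : Fin (K + 3)} (hi : (i : ℕ) ≠ K + 1) {u : ℝ} (hu : 0 < u) (hu1 : (i : ℕ) < K → u < 1)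
    (huK : K ≤ (i : ℕ) → d * c * u < h) :
    linePoint K m s c d i 0 u ∈ openSegment ℝ ((zigzagDiagram K s c d h covers).vertex i)
      ((zigzagDiagram K s c d h covers).vertex (i + 1)) := by
  have e1 := Z.start_eq_linePoint (covers := covers) hm hi 0
  have e2 := Z.end_eq_linePoint (covers := covers) hm hi 0
  rw [Complex.ofReal_zero, zero_mul, add_zero] at e1
  rw [Complex.ofReal_zero, zero_mul, sub_zero] at e2
  rw [e1, e2]
  exact add_smul_mem_openSegment _ _ (Z.height_between i.2 hi hu hu1 fun hK => by
    rw [zero_mul, add_zero]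
    exact huK hK)

theorem mem_openStrand (Z : IsZigzag K s c d h) (hm : 2 * m * (d * s * c) = 1)
    {i : Fin (K + 3)} (hi : (i : ℕ) ≠ K + 1) {b : Bool} {u : ℝ} (hu : 0 < u)
    (hu1 : (i : ℕ) < K → u < 1)
    (huK : K ≤ (i : ℕ) → d * c * u < h + (sideInt b : ℝ) * (1 / 2)) :
    linePoint K m s c d i (sideInt b : ℝ) u ∈
      openSegment ℝ ((zigzagDiagram K s c d h covers).strandStart (i, b))
        ((zigzagDiagram K s c d h covers).strandEnd (i, b)) := by
  rw [Z.strandStart_eq hm hi, Z.strandEnd_eq hm hi]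
  exact add_smul_mem_openSegment _ _ (Z.height_between i.2 hi hu hu1 huK)

end IsZigzag

/-! ### Which edges cross which strands. -/

namespace IsZigzag

variable {K m : ℕ} {s c d h : ℝ} {covers : Fin (K + 3) → Fin (K + 3) → Prop}

theorem lineSlope_sq (K i : ℕ) : lineSlope K i * lineSlope K i = 1 := by
  rcases lineSlope_cases K i with h | h <;> rw [h] <;> norm_num

theorem linePoint_eq_of_crosses {i j : ℕ} {σ : ℤ} (hc : Crosses K m i j σ) :
    linePoint K m s c d i 0 (1 / 2) = linePoint K m s c d j σ (1 / 2) := by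
  obtain ⟨h1, h2⟩ := hc
  apply Complex.ext
  · rw [linePoint_re, linePoint_re, h1]
    have h3 : lineBase K j - lineBase K i + lineSlope K i * σ * m = lineSlope K i := by
      linear_combination lineSlope K i * h2 - (lineBase K j - lineBase K i) * lineSlope_sq K i
    have h4 : ((lineBase K j - lineBase K i + lineSlope K i * σ * m : ℤ) : ℝ) = lineSlope K i := by
      rw [h3]
    push_cast at h4 ⊢
    linear_combination -(d * s) * h4
  · rw [linePoint_im, linePoint_im]

/-- Twice the height of an intersection is an even number plus or minus the odd number m, hence odd.
It lies in [0, 2] as soon as one of the two edges belongs to the zigzag, so the height is 1/2. -/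
theorem crosses_of_linePoint_eq (Z : IsZigzag K s c d h) (hodd : Odd m) (hmK : m ≤ K)
    {i j : ℕ} (hi3 : i < K + 3) (hj3 : j < K + 3) (hi : i ≠ K + 1) (hj : j ≠ K + 1) {b : Bool}
    {u u' : ℝ} (hu : 0 ≤ u) (hui : i < K → u ≤ 1) (huj : j < K → u' ≤ 1)
    (he : linePoint K m s c d i 0 u = linePoint K m s c d j (sideInt b) u') :
    Crosses K m i j (sideInt b) ∧ u = 1 / 2 ∧ u' = 1 / 2 := by
  have hdc : d * c ≠ 0 := (mul_pos Z.d_pos Z.c_pos).ne'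
  have hds : d * s ≠ 0 := (mul_pos Z.d_pos Z.s_pos).ne'
  have him := congrArg Complex.im he
  rw [linePoint_im, linePoint_im] at him
  have huu := mul_left_cancel₀ hdc him
  subst huu
  have hre := congrArg Complex.re he
  rw [linePoint_re, linePoint_re] at hre
  have hre := mul_left_cancel₀ hds hre
  obtain ⟨a, ha⟩ := even_lineBase K i
  obtain ⟨a', ha'⟩ := even_lineBase K j
  obtain ⟨r, hr⟩ := hodd
  have hmz : (m : ℤ) = 2 * r + 1 := by exact_mod_cast hr
  have hσ : sideInt b = 1 ∨ sideInt b = -1 := by cases b <;> simp [sideInt]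
  -- On parallel lines, equality would make a difference of even bases equal to ±m, which is odd.
  have hslope : lineSlope K j = -lineSlope K i := by
    by_contra hne
    have heq : lineSlope K j = lineSlope K i := by
      rcases lineSlope_cases K i with h1 | h1 <;> rcases lineSlope_cases K j with h2 | h2 <;>
        rw [h1, h2] at hne ⊢ <;> simp at hne
    rw [heq] at hre
    have hint : lineBase K i = lineBase K j - lineSlope K i * sideInt b * m := by
      have : (lineBase K i : ℝ) = lineBase K j - lineSlope K i * sideInt b * m := by linarith
      exact_mod_cast this
    rcases lineSlope_cases K i with h1 | h1 <;> rcases hσ with h2 | h2 <;> rw [h1, h2] at hint <;>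
      omega
  -- Equating the abscissae on lines of opposite slope gives twice the common height.
  have hW : ((lineSlope K i * (lineBase K j - lineBase K i) + sideInt b * m : ℤ) : ℝ) = 2 * u := by
    have hsq : ((lineSlope K i : ℤ) : ℝ) * lineSlope K i = 1 := by exact_mod_cast lineSlope_sq K i
    rw [hslope] at hre
    push_cast at hre ⊢
    linear_combination (-(lineSlope K i : ℝ)) * hre + (2 * u - sideInt b * m) * hsq
  have hW0 : 0 ≤ lineSlope K i * (lineBase K j - lineBase K i) + sideInt b * m := by
    have : (0 : ℝ) ≤ ((lineSlope K i * (lineBase K j - lineBase K i) + sideInt b * m : ℤ) : ℝ) := by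
      rw [hW]
      linarith
    exact_mod_cast this
  have hWle : u ≤ 1 → lineSlope K i * (lineBase K j - lineBase K i) + sideInt b * m ≤ 2 := by
    intro h1
    have : ((lineSlope K i * (lineBase K j - lineBase K i) + sideInt b * m : ℤ) : ℝ) ≤ 2 := by
      rw [hW]
      linarith
    exact_mod_cast this
  have hW1 : lineSlope K i * (lineBase K j - lineBase K i) + sideInt b * m = 1 := by
    by_cases h1 : i < K ∨ j < K
    · have := hWle (h1.elim hui huj)
      rcases lineSlope_cases K i with h1 | h1 <;> rcases hσ with h2 | h2 <;>
        rw [h1, h2] at this hW0 ⊢ <;> omega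
    -- Both edges are now among K and K + 2. For opposite slopes twice the height would be -K ± m,
    -- which is negative since m ≤ K and the parities differ.
    · exfalso
      have hK := Z.even
      obtain ⟨k, hk⟩ := id hK
      obtain h2 | h2 : i = K ∨ i = K + 2 := by omega
      · obtain h3 | h3 : j = K ∨ j = K + 2 := by omega
        · rw [h2, h3, lineSlope_K hK] at hslope
          norm_num at hslope
        · rw [h2, h3, lineSlope_K hK, lineBase_K hK, lineBase_A] at hW0
          rcases hσ with h2 | h2 <;> rw [h2] at hW0 <;> omega
      · obtain h3 | h3 : j = K ∨ j = K + 2 := by omega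
        · rw [h2, h3, lineSlope_A, lineBase_K hK, lineBase_A] at hW0
          rcases hσ with h2 | h2 <;> rw [h2] at hW0 <;> omega
        · rw [h2, h3, lineSlope_A] at hslope
          norm_num at hslope
  refine ⟨⟨hslope, hW1⟩, ?_, ?_⟩ <;>
  · rw [hW1, Int.cast_one] at hW
    linarith

theorem planeCross_slope (s c : ℝ) {ρ ρ' : ℤ} (h : ρ' = -ρ) :
    planeCross ⟨s, ρ * c⟩ ⟨s, ρ' * c⟩ = -(2 * ρ * (s * c)) := by
  rw [h]
  simp only [planeCross, Complex.mul_im, Complex.conj_re, Complex.conj_im]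
  push_cast
  ring

theorem planeCross_slope_left (s c : ℝ) (ρ : ℤ) : planeCross (-1) ⟨s, ρ * c⟩ = -(ρ * c) := by
  simp [planeCross]

theorem planeCross_slope_right (s c : ℝ) (ρ : ℤ) : planeCross ⟨s, ρ * c⟩ (-1) = ρ * c := by
  simp [planeCross]

theorem lt_add_side (hh : d * c < h - 1 / 2) (b : Bool) :
    d * c < h + (sideInt b : ℝ) * (1 / 2) := by
  cases b <;> simp [sideInt] <;> linarith

/-- Intersections of edges and strands other than those between the last two vertices. -/
theorem inter_edge_strand (Z : IsZigzag K s c d h) (hm : 2 * m * (d * s * c) = 1) (hodd : Odd m)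
    (hmK : m ≤ K) (hh : d * c < h - 1 / 2) {i j : Fin (K + 3)} (hi : (i : ℕ) ≠ K + 1)
    (hj : (j : ℕ) ≠ K + 1) (b : Bool) {x : ℂ}
    (hx : x ∈ segment ℝ ((zigzagDiagram K s c d h covers).vertex i)
        ((zigzagDiagram K s c d h covers).vertex (i + 1)))
    (hx' : x ∈ segment ℝ ((zigzagDiagram K s c d h covers).strandStart (j, b))
        ((zigzagDiagram K s c d h covers).strandEnd (j, b))) :
    Crosses K m i j (sideInt b) ∧ x = linePoint K m s c d i 0 (1 / 2) := by
  rw [Z.edge_eq_image hm hi] at hx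
  rw [Z.strand_eq_image hm hj] at hx'
  obtain ⟨u, hu, rfl⟩ := hx
  obtain ⟨u', hu', e⟩ := hx'
  have hdc : 0 < d * c := mul_pos Z.d_pos Z.c_pos
  have h1 := Z.height_mem i.2 hi (by linarith) hu
  have h2 := Z.height_mem j.2 hj (lt_add_side hh b) hu'
  obtain ⟨h3, rfl, -⟩ := Z.crosses_of_linePoint_eq hodd hmK i.2 j.2 hi hj h1.1 h1.2.1 h2.2.1 e.symm
  exact ⟨h3, rfl⟩

theorem mem_open_of_crosses (Z : IsZigzag K s c d h) (hm : 2 * m * (d * s * c) = 1)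
    (hh : d * c < h - 1 / 2) {i j : Fin (K + 3)} (hi : (i : ℕ) ≠ K + 1)
    (hj : (j : ℕ) ≠ K + 1) {b : Bool} (hcr : Crosses K m i j (sideInt b)) :
    linePoint K m s c d i 0 (1 / 2) ∈ openSegment ℝ ((zigzagDiagram K s c d h covers).vertex i)
        ((zigzagDiagram K s c d h covers).vertex (i + 1)) ∧
      linePoint K m s c d i 0 (1 / 2) ∈
        openSegment ℝ ((zigzagDiagram K s c d h covers).strandStart (j, b))
        ((zigzagDiagram K s c d h covers).strandEnd (j, b)) := by
  have hdc : 0 < d * c := mul_pos Z.d_pos Z.c_pos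
  have hb := lt_add_side hh b
  refine ⟨Z.mem_openEdge hm hi (by norm_num) (fun _ => by norm_num) fun _ => by linarith, ?_⟩
  rw [linePoint_eq_of_crosses hcr]
  refine Z.mem_openStrand hm hj (by norm_num) (fun _ => by norm_num) fun _ => ?_
  linarith

/-- The strands of the edge between the last two vertices are horizontal. -/
theorem strand_E (Z : IsZigzag K s c d h) {i : Fin (K + 3)} (hi : (i : ℕ) = K + 1) (σ : ℝ) :
    (zigzagDiagram K s c d h covers).vertex i + σ * (zigzagDiagram K s c d h covers).foldVec i =
      (⟨0, h - σ * (1 / 2)⟩ : ℂ) +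
        (K * (d * s) + h * (s / c) + σ * ((1 - s) / (2 * c))) • (1 : ℂ) ∧
    (zigzagDiagram K s c d h covers).vertex (i + 1) -
      σ * (zigzagDiagram K s c d h covers).foldVec (i + 1) =
      (⟨0, h - σ * (1 / 2)⟩ : ℂ) + (-(h * (s / c)) - σ * ((1 - s) / (2 * c))) • (1 : ℂ) := by
  have hi1 : ((i + 1 : Fin (K + 3)) : ℕ) = K + 2 := by
    rw [fin_val_add_one, if_neg (by omega), hi]
  constructor
  · rw [Z.foldVec_eq, vertex_eq_of_eq hi, fold_eq_of_eq hi, Z.div_one_add]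
    generalize (1 - s) / (2 * c) = w
    apply Complex.ext <;> simp
    ring
  · rw [Z.foldVec_eq, vertex_eq_of_eq' hi1, fold_eq_of_eq' hi1, Z.div_one_add]
    generalize (1 - s) / (2 * c) = w
    apply Complex.ext <;> simp

theorem strandStart_E (Z : IsZigzag K s c d h) {i : Fin (K + 3)} (hi : (i : ℕ) = K + 1)
    (b : Bool) : (zigzagDiagram K s c d h covers).strandStart (i, b) =
      (⟨0, h - sideInt b * (1 / 2)⟩ : ℂ) +
        (K * (d * s) + h * (s / c) + sideInt b * ((1 - s) / (2 * c))) • (1 : ℂ) := by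
  rw [← (Z.strand_E (covers := covers) hi _).1]
  exact congrArg (fun t => (zigzagDiagram K s c d h covers).vertex i + t * _) (sideSign_eq b)

theorem strandEnd_E (Z : IsZigzag K s c d h) {i : Fin (K + 3)} (hi : (i : ℕ) = K + 1)
    (b : Bool) : (zigzagDiagram K s c d h covers).strandEnd (i, b) =
      (⟨0, h - sideInt b * (1 / 2)⟩ : ℂ) +
        (-(h * (s / c)) - sideInt b * ((1 - s) / (2 * c))) • (1 : ℂ) := by
  rw [← (Z.strand_E (covers := covers) hi _).2]
  exact congrArg (fun t => (zigzagDiagram K s c d h covers).vertex (i + 1) - t * _) (sideSign_eq b)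

theorem edge_E (Z : IsZigzag K s c d h) {i : Fin (K + 3)} (hi : (i : ℕ) = K + 1) :
    (zigzagDiagram K s c d h covers).vertex i =
      (⟨0, h⟩ : ℂ) + (K * (d * s) + h * (s / c)) • (1 : ℂ) ∧
    (zigzagDiagram K s c d h covers).vertex (i + 1) =
      (⟨0, h⟩ : ℂ) + (-(h * (s / c))) • (1 : ℂ) := by
  have := Z.strand_E (covers := covers) hi 0
  simpa using this

theorem im_of_mem_segment_add_smul {y a b : ℝ} {z : ℂ}
    (hz : z ∈ segment ℝ ((⟨0, y⟩ : ℂ) + a • (1 : ℂ)) ((⟨0, y⟩ : ℂ) + b • (1 : ℂ))) : z.im = y := by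
  rw [segment_add_smul] at hz
  obtain ⟨u, -, rfl⟩ := hz
  simp

theorem not_inter_E_E (Z : IsZigzag K s c d h) {i j : Fin (K + 3)} (hi : (i : ℕ) = K + 1)
    (hj : (j : ℕ) = K + 1) (b : Bool) {x : ℂ} :
    ¬ (x ∈ segment ℝ ((zigzagDiagram K s c d h covers).vertex i)
        ((zigzagDiagram K s c d h covers).vertex (i + 1)) ∧
      x ∈ segment ℝ ((zigzagDiagram K s c d h covers).strandStart (j, b))
        ((zigzagDiagram K s c d h covers).strandEnd (j, b))) := by
  rintro ⟨hx, hx'⟩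
  rw [Z.strandStart_E hj, Z.strandEnd_E hj] at hx'
  rw [(Z.edge_E hi).1, (Z.edge_E hi).2] at hx
  have h1 := im_of_mem_segment_add_smul hx
  have h2 := im_of_mem_segment_add_smul hx'
  rw [h1] at h2
  cases b <;> simp [sideInt] at h2
  linarith

theorem mem_openSegment_horizontal {y a b : ℝ} {z : ℂ} (hy : z.im = y) (h1 : b < z.re)
    (h2 : z.re < a) :
    z ∈ openSegment ℝ ((⟨0, y⟩ : ℂ) + a • (1 : ℂ)) ((⟨0, y⟩ : ℂ) + b • (1 : ℂ)) := by
  have : z = (⟨0, y⟩ : ℂ) + z.re • (1 : ℂ) := by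
    apply Complex.ext <;> simp [hy]
  rw [this]
  exact add_smul_mem_openSegment _ _ (Or.inr ⟨h1, h2⟩)

/-- The horizontal position of the points at large height on the edges at the ends of the zigzag. -/
theorem linePoint_re_bounds (Z : IsZigzag K s c d h) (hm : 2 * m * (d * s * c) = 1)
    (hmK : m ≤ K) {i : ℕ} (hi : i = K ∨ i = K + 2) {σ u : ℝ} (hσ : 0 ≤ σ ∧ σ ≤ 1) (hu : 0 < u) :
    -(d * s * u) ≤ (linePoint K m s c d i σ u).re ∧
      (linePoint K m s c d i σ u).re ≤ K * (d * s) + d * s * u ∧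
      (0 < σ → -(d * s * u) < (linePoint K m s c d i σ u).re ∧
        (linePoint K m s c d i σ u).re < K * (d * s) + d * s * u) := by
  have hds : 0 < d * s := mul_pos Z.d_pos Z.s_pos
  have hm0 : (0 : ℝ) < m := by
    have hm1 : m ≠ 0 := by
      rintro rfl
      norm_num at hm
    exact_mod_cast Nat.pos_of_ne_zero hm1
  have hmK' : (m : ℝ) ≤ K := by exact_mod_cast hmK
  have h1 : d * s * (σ * m) ≤ K * (d * s) := by
    have : σ * m ≤ K := (mul_le_of_le_one_left hm0.le hσ.2).trans hmK'
    nlinarith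
  have h0 : 0 ≤ d * s * (σ * m) := by
    have := hσ.1
    positivity
  have hdsu : 0 < d * s * u := by positivity
  have hKds : 0 < K * (d * s) := mul_pos (hm0.trans_le hmK') hds
  rw [linePoint_re]
  rcases hi with rfl | rfl
  · rw [lineBase_K Z.even, lineSlope_K Z.even]
    push_cast
    refine ⟨by linarith, by linarith, fun hp => ?_⟩
    have : 0 < d * s * (σ * m) := by positivity
    constructor <;> linarith
  · rw [lineBase_A, lineSlope_A]
    push_cast
    refine ⟨by linarith, by linarith, fun hp => ?_⟩
    have : 0 < d * s * (σ * m) := by positivity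
    constructor <;> linarith

/-- Intersections of the edge between the last two vertices with the other strands. -/
theorem inter_E_strand (Z : IsZigzag K s c d h) (hm : 2 * m * (d * s * c) = 1)
    (hh : d * c < h - 1 / 2) {i j : Fin (K + 3)} (hi : (i : ℕ) = K + 1)
    (hj : (j : ℕ) ≠ K + 1) {b : Bool} {x : ℂ}
    (hx : x ∈ segment ℝ ((zigzagDiagram K s c d h covers).vertex i)
        ((zigzagDiagram K s c d h covers).vertex (i + 1)))
    (hx' : x ∈ segment ℝ ((zigzagDiagram K s c d h covers).strandStart (j, b))
        ((zigzagDiagram K s c d h covers).strandEnd (j, b))) :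
    K ≤ (j : ℕ) ∧ b = true ∧ x = linePoint K m s c d j 1 (h / (d * c)) := by
  have hdc : 0 < d * c := mul_pos Z.d_pos Z.c_pos
  rw [(Z.edge_E hi).1, (Z.edge_E hi).2] at hx
  have him := im_of_mem_segment_add_smul hx
  rw [Z.strand_eq_image hm hj] at hx'
  obtain ⟨u, hu, rfl⟩ := hx'
  have h2 := Z.height_mem j.2 hj (lt_add_side hh b) hu
  rw [linePoint_im] at him
  -- Strands of zigzag edges stay at height at most d c, below h.
  have hjK : K ≤ (j : ℕ) := by
    by_contra! h3
    have := h2.2.1 h3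
    nlinarith
  have h4 := h2.2.2 hjK
  rw [him] at h4
  have hu' : u = h / (d * c) := by
    rw [eq_div_iff hdc.ne']
    linarith
  -- The right strand only reaches height h - 1/2, so it misses the edge EA.
  cases b
  · exfalso
    simp [sideInt] at h4
    linarith
  · refine ⟨hjK, rfl, ?_⟩
    rw [hu']
    simp [sideInt]

theorem mem_open_E_strand (Z : IsZigzag K s c d h) (hm : 2 * m * (d * s * c) = 1) (hmK : m ≤ K)
    {i j : Fin (K + 3)} (hi : (i : ℕ) = K + 1)
    (hj : (j : ℕ) = K ∨ (j : ℕ) = K + 2) :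
    linePoint K m s c d j 1 (h / (d * c)) ∈
        openSegment ℝ ((zigzagDiagram K s c d h covers).vertex i)
        ((zigzagDiagram K s c d h covers).vertex (i + 1)) ∧
      linePoint K m s c d j 1 (h / (d * c)) ∈
        openSegment ℝ ((zigzagDiagram K s c d h covers).strandStart (j, true))
        ((zigzagDiagram K s c d h covers).strandEnd (j, true)) := by
  have hc := Z.c_pos
  have hd := Z.d_pos
  have hh0 := Z.h_pos
  have hdc : 0 < d * c := mul_pos hd hc
  have hu : 0 < h / (d * c) := by positivity
  have e1 : d * c * (h / (d * c)) = h := by field_simp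
  have e2 : d * s * (h / (d * c)) = h * (s / c) := by field_simp
  constructor
  · rw [(Z.edge_E hi).1, (Z.edge_E hi).2]
    have hb := (Z.linePoint_re_bounds hm hmK hj ⟨zero_le_one, le_rfl⟩ hu).2.2 zero_lt_one
    rw [e2] at hb
    exact mem_openSegment_horizontal (by rw [linePoint_im, e1]) hb.1 hb.2
  · have := Z.mem_openStrand (covers := covers) hm (i := j) (by omega) (b := true) hu
      (fun h => by omega) (fun _ => by
        rw [e1]
        simp [sideInt])
    simpa [sideInt] using this

/-- Intersections of the strands between the last two vertices with the other edges. -/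
theorem inter_edge_strand_E (Z : IsZigzag K s c d h) (hm : 2 * m * (d * s * c) = 1)
    (hh : d * c < h - 1 / 2) {i j : Fin (K + 3)} (hi : (i : ℕ) ≠ K + 1)
    (hj : (j : ℕ) = K + 1) {b : Bool} {x : ℂ}
    (hx : x ∈ segment ℝ ((zigzagDiagram K s c d h covers).vertex i)
        ((zigzagDiagram K s c d h covers).vertex (i + 1)))
    (hx' : x ∈ segment ℝ ((zigzagDiagram K s c d h covers).strandStart (j, b))
        ((zigzagDiagram K s c d h covers).strandEnd (j, b))) :
    K ≤ (i : ℕ) ∧ b = true ∧ x = linePoint K m s c d i 0 ((h - 1 / 2) / (d * c)) := by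
  have hdc : 0 < d * c := mul_pos Z.d_pos Z.c_pos
  rw [Z.strandStart_E hj, Z.strandEnd_E hj] at hx'
  have him := im_of_mem_segment_add_smul hx'
  rw [Z.edge_eq_image hm hi] at hx
  obtain ⟨u, hu, rfl⟩ := hx
  have h2 := Z.height_mem i.2 hi (by linarith) hu
  rw [linePoint_im] at him
  have hb : -((sideInt b : ℝ) * (1 / 2)) ≥ -(1 / 2) := by
    cases b <;> simp [sideInt]
  have hiK : K ≤ (i : ℕ) := by
    by_contra! h3
    have := h2.2.1 h3
    nlinarith
  have h4 := h2.2.2 hiK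
  rw [him] at h4
  cases b
  · exfalso
    simp [sideInt] at h4
    linarith
  · refine ⟨hiK, rfl, ?_⟩
    congr 1
    rw [eq_div_iff hdc.ne']
    simp [sideInt] at him
    linarith

theorem mem_open_edge_strand_E (Z : IsZigzag K s c d h) (hm : 2 * m * (d * s * c) = 1)
    (hmK : m ≤ K) (hh : d * c < h - 1 / 2) {i j : Fin (K + 3)} (hi : (i : ℕ) = K ∨ (i : ℕ) = K + 2)
    (hj : (j : ℕ) = K + 1) :
    linePoint K m s c d i 0 ((h - 1 / 2) / (d * c)) ∈
        openSegment ℝ ((zigzagDiagram K s c d h covers).vertex i)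
        ((zigzagDiagram K s c d h covers).vertex (i + 1)) ∧
      linePoint K m s c d i 0 ((h - 1 / 2) / (d * c)) ∈
        openSegment ℝ ((zigzagDiagram K s c d h covers).strandStart (j, true))
        ((zigzagDiagram K s c d h covers).strandEnd (j, true)) := by
  have hc := Z.c_pos
  have hd := Z.d_pos
  have hh0 := Z.h_pos
  have hdc : 0 < d * c := mul_pos hd hc
  have hu : 0 < (h - 1 / 2) / (d * c) := div_pos (by linarith) hdc
  have e1 : d * c * ((h - 1 / 2) / (d * c)) = h - 1 / 2 := by field_simp
  have e2 : d * s * ((h - 1 / 2) / (d * c)) = h * (s / c) - s / (2 * c) := by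
    field_simp
  constructor
  · exact Z.mem_openEdge hm (by omega) hu (fun h => by omega) fun _ => by
      rw [e1]
      linarith
  · rw [Z.strandStart_E hj, Z.strandEnd_E hj]
    simp only [sideInt, if_true, Int.cast_one, one_mul]
    -- The edges may attain these bounds, but the strand extends beyond them at both ends by s/(2c)
    -- + (1-s)/(2c).
    have hb := Z.linePoint_re_bounds hm hmK hi ⟨le_rfl, zero_le_one⟩ hu
    rw [e2] at hb
    have hs := Z.s_pos
    have hs1 : 0 < 1 - s := by nlinarith [Z.sq]
    have hp : 0 < (1 - s) / (2 * c) := by positivity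
    have hp' : 0 < s / (2 * c) := by positivity
    exact mem_openSegment_horizontal (by
      rw [linePoint_im, e1]) (by linarith [hb.1]) (by linarith [hb.2.1])

end IsZigzag

/-! #### Counting the crossings -/

/-- The sign of the crossings between the edges of positions `q - m` and `q`, where positions are
counted from the edge before the vertex `0`. -/
def pairSign (m q : ℕ) : ℤ := if q ≤ 2 * m then (if q % 2 = 0 then 1 else -1) else 1

/-- The height of the edge of position `p` in the stack. -/
def positionLevel (m p : ℕ) : ℤ :=
  if p ≤ 2 * m then (p : ℤ) - 1 else if p % 2 = 1 then -((p : ℤ) - 1) else (p : ℤ) - 1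

/-- Half of the contribution of the positions `p` and `q` to the linking number. -/
def pairContribution (K m p q : ℕ) : ℤ :=
  if p < K + 2 ∧ q < K + 2 ∧ p + m = q then pairSign m q else 0

/-- The sign of the crossings of the horizontal edge with the edge of position `q`. -/
def horizontalContribution (K q : ℕ) : ℤ := (if q = K + 1 then 1 else 0) - (if q = 0 then 1 else 0)

/-- As m is odd, the m + 1 alternating signs cancel in pairs. -/
theorem sum_alternating (m : ℕ) (hm : Odd m) :
    ∑ q ∈ Finset.range (m + 1), pairSign m (m + q) = 0 := by
  obtain ⟨r, rfl⟩ := hm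
  have key : ∀ k ≤ r + 1, ∑ q ∈ Finset.range (2 * k), pairSign (2 * r + 1) (2 * r + 1 + q) = 0 := by
    intro k
    induction k with
    | zero => simp
    | succ k ih =>
      intro hk
      rw [show 2 * (k + 1) = 2 * k + 1 + 1 by ring, Finset.sum_range_succ, Finset.sum_range_succ,
        ih (by omega)]
      rw [pairSign, if_pos (by omega), if_neg (by omega), pairSign, if_pos (by omega),
        if_pos (by omega)]
      norm_num
  exact key (r + 1) le_rfl

theorem sum_pairContribution {m : ℕ} (n : ℕ) (hm : Odd m) :
    ∑ p ∈ Finset.range (2 * m + 2 * n + 3), ∑ q ∈ Finset.range (2 * m + 2 * n + 3),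
      pairContribution (2 * m + 2 * n) m p q = 2 * n + 1 := by
  rw [Finset.sum_comm]
  have h1 : ∀ q ∈ Finset.range (2 * m + 2 * n + 3), ∑ p ∈ Finset.range (2 * m + 2 * n + 3),
      pairContribution (2 * m + 2 * n) m p q =
        if q < 2 * m + 2 * n + 2 ∧ m ≤ q then pairSign m q else 0 := by
    intro q hq
    rw [Finset.mem_range] at hq
    rw [Finset.sum_eq_single (q - m)]
    · rw [pairContribution]
      congr 1
      apply propext
      omega
    · intro p _ hp
      rw [pairContribution, if_neg (by omega)]
    · intro h
      rw [Finset.mem_range] at h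
      omega
  -- The range splits into q < m, where no position q - m exists, then the alternating stretch m ≤ q
  -- ≤ 2m, and then one position for each of the 2n + 1 half-wraps.
  rw [Finset.sum_congr rfl h1, Finset.sum_range_succ, if_neg (by omega), add_zero,
    show 2 * m + 2 * n + 2 = m + (m + 1) + (2 * n + 1) by ring, Finset.sum_range_add,
    Finset.sum_range_add]
  have h2 : ∀ q ∈ Finset.range m,
      (if q < m + (m + 1) + (2 * n + 1) ∧ m ≤ q then pairSign m q else 0) = 0 := fun q hq => by
    rw [Finset.mem_range] at hq
    rw [if_neg (by omega)]
  have h3 : ∀ q ∈ Finset.range (m + 1),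
      (if m + q < m + (m + 1) + (2 * n + 1) ∧ m ≤ m + q then pairSign m (m + q) else 0) =
        pairSign m (m + q) := fun q hq => by
    rw [Finset.mem_range] at hq
    rw [if_pos (by omega)]
  have h4 : ∀ q ∈ Finset.range (2 * n + 1),
      (if m + (m + 1) + q < m + (m + 1) + (2 * n + 1) ∧ m ≤ m + (m + 1) + q then
        pairSign m (m + (m + 1) + q) else 0) = 1 := fun q hq => by
    rw [Finset.mem_range] at hq
    rw [if_pos (by omega), pairSign, if_neg (by omega)]
  rw [Finset.sum_congr rfl h2, Finset.sum_congr rfl h3, Finset.sum_congr rfl h4,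
    sum_alternating m hm]
  simp

theorem sum_horizontalContribution (K : ℕ) :
    ∑ q ∈ Finset.range (K + 3), horizontalContribution K q = 0 := by
  simp [horizontalContribution, Finset.sum_sub_distrib]

theorem sum_contributions {m : ℕ} (n : ℕ) (hm : Odd m) :
    ∑ p ∈ Finset.range (2 * m + 2 * n + 3), ∑ q ∈ Finset.range (2 * m + 2 * n + 3),
      (pairContribution (2 * m + 2 * n) m p q + pairContribution (2 * m + 2 * n) m q p +
        (if p = 2 * m + 2 * n + 2 then horizontalContribution (2 * m + 2 * n) q else 0) +
        (if q = 2 * m + 2 * n + 2 then horizontalContribution (2 * m + 2 * n) p else 0)) =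
      2 * (2 * n + 1) := by
  simp only [Finset.sum_add_distrib]
  have h1 : ∑ p ∈ Finset.range (2 * m + 2 * n + 3), ∑ q ∈ Finset.range (2 * m + 2 * n + 3),
      (if p = 2 * m + 2 * n + 2 then horizontalContribution (2 * m + 2 * n) q else 0) = 0 := by
    refine Finset.sum_eq_zero fun p _ => ?_
    split_ifs
    · exact sum_horizontalContribution _
    · exact Finset.sum_const_zero
  have h2 : ∑ p ∈ Finset.range (2 * m + 2 * n + 3), ∑ q ∈ Finset.range (2 * m + 2 * n + 3),
      (if q = 2 * m + 2 * n + 2 then horizontalContribution (2 * m + 2 * n) p else 0) = 0 := by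
    rw [Finset.sum_comm, h1]
  have h3 : ∑ p ∈ Finset.range (2 * m + 2 * n + 3), ∑ q ∈ Finset.range (2 * m + 2 * n + 3),
      pairContribution (2 * m + 2 * n) m q p = 2 * n + 1 := by
    rw [Finset.sum_comm, sum_pairContribution n hm]
  rw [h1, h2, h3, sum_pairContribution n hm]
  ring

/-- The position of an edge: `0` for the edge before the vertex `0`, then `1, …, K + 1` for the edges
of the zigzag and the one after it, and `K + 2` for the horizontal edge. -/
def position {K : ℕ} (i : Fin (K + 3)) : ℕ := (i + 1 : Fin (K + 3))

theorem position_eq {K : ℕ} (i : Fin (K + 3)) :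
    position i = if (i : ℕ) = K + 2 then 0 else (i : ℕ) + 1 := fin_val_add_one i

theorem sum_position {K : ℕ} (g : ℕ → ℤ) :
    ∑ i : Fin (K + 3), g (position i) = ∑ p ∈ Finset.range (K + 3), g p := by
  rw [← Fin.sum_univ_eq_sum_range g]
  exact Equiv.sum_comp (Equiv.addRight (1 : Fin (K + 3))) fun i => g i

theorem sum_sum_position {K : ℕ} (f : ℕ → ℕ → ℤ) :
    ∑ i : Fin (K + 3), ∑ j : Fin (K + 3), f (position i) (position j) =
      ∑ p ∈ Finset.range (K + 3), ∑ q ∈ Finset.range (K + 3), f p q := by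
  rw [← sum_position]
  exact Finset.sum_congr rfl fun i _ => sum_position _

theorem lineSlope_eq_position {K : ℕ} {i : Fin (K + 3)} (hi : (i : ℕ) ≠ K + 1) :
    lineSlope K i = if position i % 2 = 1 then 1 else -1 := by
  have := i.2
  simp only [lineSlope, position_eq, Nat.even_iff]
  split_ifs <;> omega

theorem lineBase_eq_position {K : ℕ} {i : Fin (K + 3)} (hi : (i : ℕ) ≠ K + 1) :
    lineBase K i = if position i % 2 = 1 then (position i : ℤ) - 1 else position i := by
  have := i.2
  simp only [lineBase, Nat.even_iff]
  have hp := position_eq i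
  split_ifs at hp ⊢ <;> omega

theorem mobiusLevel_eq_position {m n : ℕ} {i : Fin (2 * m + 2 * n + 3)}
    (hi : (i : ℕ) ≠ 2 * m + 2 * n + 1) : mobiusLevel m n i = positionLevel m (position i) := by
  have := i.2
  simp only [mobiusLevel, positionLevel, position_eq, Nat.even_iff]
  split_ifs <;> omega

/-- In terms of positions the crossing condition reads q = p + m on one side and p = q + m on the
other, and slopes are opposite exactly when parities are. Beyond 2m the later piece alternates
between bottom and top, which compensates the alternating slope and makes every sign +1. -/
theorem sum_crosses {K m p q : ℕ} (hm : Odd m) (hp : p < K + 2) (hq : q < K + 2) {ρ ρ' κ κ' : ℤ}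
    (hρ : ρ = if p % 2 = 1 then 1 else -1) (hρ' : ρ' = if q % 2 = 1 then 1 else -1)
    (hκ : κ = if p % 2 = 1 then (p : ℤ) - 1 else p)
    (hκ' : κ' = if q % 2 = 1 then (q : ℤ) - 1 else q) :
    ((if ρ' = -ρ ∧ ρ * (κ' - κ) + 1 * m = 1 then
        (if positionLevel m q < positionLevel m p then -ρ else ρ) else 0) +
      if ρ' = -ρ ∧ ρ * (κ' - κ) + -1 * m = 1 then
        (if positionLevel m q < positionLevel m p then -ρ else ρ) else 0) =
      pairContribution K m p q + pairContribution K m q p := by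
  obtain ⟨r, hr⟩ := hm
  rcases Nat.mod_two_eq_zero_or_one p with h1 | h1 <;>
    rcases Nat.mod_two_eq_zero_or_one q with h2 | h2
  · rw [h1, if_neg (by norm_num)] at hρ
    rw [h2, if_neg (by norm_num)] at hρ'
    rw [if_neg (by omega), if_neg (by omega), pairContribution, pairContribution,
      if_neg (by omega), if_neg (by omega)]
  · rw [h1, if_neg (by norm_num)] at hρ hκ
    rw [h2, if_pos rfl] at hρ' hκ'
    subst hρ hρ' hκ hκ'
    simp only [pairContribution, positionLevel, pairSign, h1, h2, if_true, if_false, zero_ne_one,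
      one_ne_zero]
    split_ifs <;> omega
  · rw [h1, if_pos rfl] at hρ hκ
    rw [h2, if_neg (by norm_num)] at hρ' hκ'
    subst hρ hρ' hκ hκ'
    simp only [pairContribution, positionLevel, pairSign, h1, h2, if_true, if_false, zero_ne_one,
      one_ne_zero, true_and]
    split_ifs <;> omega
  · rw [h1, if_pos rfl] at hρ
    rw [h2, if_pos rfl] at hρ'
    rw [if_neg (by omega), if_neg (by omega), pairContribution, pairContribution,
      if_neg (by omega), if_neg (by omega)]

/-! ### Transversality and signs of the crossings. -/

namespace IsZigzag

variable {K m : ℕ} {s c d h : ℝ} {covers : Fin (K + 3) → Fin (K + 3) → Prop}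

theorem crossings_transverse (Z : IsZigzag K s c d h) (hm : 2 * m * (d * s * c) = 1)
    (hodd : Odd m) (hmK : m ≤ K) (hh : d * c < h - 1 / 2) (i : Fin (K + 3)) (p : Fin (K + 3) × Bool)
    {x : ℂ} (hx : x ∈ segment ℝ ((zigzagDiagram K s c d h covers).vertex i)
        ((zigzagDiagram K s c d h covers).vertex (i + 1)))
    (hx' : x ∈ segment ℝ ((zigzagDiagram K s c d h covers).strandStart p)
        ((zigzagDiagram K s c d h covers).strandEnd p)) :
    x ∈ openSegment ℝ ((zigzagDiagram K s c d h covers).vertex i)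
        ((zigzagDiagram K s c d h covers).vertex (i + 1)) ∧
      x ∈ openSegment ℝ ((zigzagDiagram K s c d h covers).strandStart p)
        ((zigzagDiagram K s c d h covers).strandEnd p) ∧
      planeCross ((zigzagDiagram K s c d h covers).dir i)
        ((zigzagDiagram K s c d h covers).dir p.1) ≠ 0 := by
  obtain ⟨j, b⟩ := p
  have hc := Z.c_pos.ne'
  have hs := Z.s_pos.ne'
  have hρ : ∀ k : ℕ, ((lineSlope K k : ℤ) : ℝ) ≠ 0 := fun k => by
    rcases lineSlope_cases K k with h | h <;> rw [h] <;> norm_num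
  rw [Z.dir_eq, Z.dir_eq]
  by_cases hi : (i : ℕ) = K + 1
  · by_cases hj : (j : ℕ) = K + 1
    · exact absurd ⟨hx, hx'⟩ (Z.not_inter_E_E hi hj b)
    · obtain ⟨h1, rfl, rfl⟩ := Z.inter_E_strand hm hh hi hj hx hx'
      have h2 := Z.mem_open_E_strand (covers := covers) hm hmK hi (j := j) (by omega)
      refine ⟨h2.1, h2.2, ?_⟩
      rw [zigzagDir_eq hj, zigzagDir, if_pos hi, planeCross_slope_left]
      exact neg_ne_zero.2 (mul_ne_zero (hρ _) hc)
  · by_cases hj : (j : ℕ) = K + 1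
    · obtain ⟨h1, rfl, rfl⟩ := Z.inter_edge_strand_E hm hh hi hj hx hx'
      have h2 := Z.mem_open_edge_strand_E (covers := covers) hm hmK hh (i := i) (by omega) hj
      refine ⟨h2.1, h2.2, ?_⟩
      rw [zigzagDir_eq hi, zigzagDir, if_pos hj, planeCross_slope_right]
      exact mul_ne_zero (hρ _) hc
    · obtain ⟨h1, rfl⟩ := Z.inter_edge_strand hm hodd hmK hh hi hj b hx hx'
      have h2 := Z.mem_open_of_crosses (covers := covers) hm hh hi hj h1
      refine ⟨h2.1, h2.2, ?_⟩
      rw [zigzagDir_eq hi, zigzagDir_eq hj, planeCross_slope _ _ h1.1]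
      exact neg_ne_zero.2 (mul_ne_zero (mul_ne_zero two_ne_zero (hρ _)) (mul_ne_zero hs hc))

theorem sign_slope_mul {ρ : ℤ} (hρ : ρ = 1 ∨ ρ = -1) {a : ℝ} (ha : 0 < a) :
    (SignType.sign ((ρ : ℝ) * a) : ℤ) = ρ := by
  rcases hρ with rfl | rfl
  · rw [Int.cast_one, one_mul, sign_pos ha]
    rfl
  · rw [Int.cast_neg, Int.cast_one, neg_one_mul, sign_neg (neg_lt_zero.2 ha)]
    rfl

open Classical in
theorem crossingSign_eq (Z : IsZigzag K s c d h) (hm : 2 * m * (d * s * c) = 1)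
    (hodd : Odd m) (hmK : m ≤ K) (hh : d * c < h - 1 / 2) {i j : Fin (K + 3)}
    (hi : (i : ℕ) ≠ K + 1) (hj : (j : ℕ) ≠ K + 1) (b : Bool) :
    (zigzagDiagram K s c d h covers).crossingSign i (j, b) =
      if Crosses K m i j (sideInt b) then
        (if covers i j then -lineSlope K i else lineSlope K i) else 0 := by
  have hsc : 0 < 2 * (s * c) := mul_pos two_pos (mul_pos Z.s_pos Z.c_pos)
  rw [RibbonDiagram.crossingSign, Z.dir_eq, Z.dir_eq]
  dsimp only
  by_cases hcr : Crosses K m i j (sideInt b)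
  · have h2 := Z.mem_open_of_crosses (covers := covers) hm hh hi hj hcr
    have hρ := lineSlope_cases K i
    have hρ' : -lineSlope K i = 1 ∨ -lineSlope K i = -1 := by omega
    rw [if_pos ⟨_, openSegment_subset_segment ℝ _ _ h2.1, openSegment_subset_segment ℝ _ _ h2.2⟩,
      if_pos hcr, zigzagDir_eq hi, zigzagDir_eq hj, planeCross_slope _ _ hcr.1,
      planeCross_slope _ _ (show lineSlope K i = -lineSlope K j by rw [hcr.1, neg_neg]), hcr.1]
    have e1 : -(2 * (lineSlope K i : ℝ) * (s * c)) =
        ((-lineSlope K i : ℤ) : ℝ) * (2 * (s * c)) := by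
      push_cast
      ring
    have e2 : -(2 * ((-lineSlope K i : ℤ) : ℝ) * (s * c)) =
        ((lineSlope K i : ℤ) : ℝ) * (2 * (s * c)) := by
      push_cast
      ring
    rw [e1, e2, sign_slope_mul hρ' hsc, sign_slope_mul hρ hsc]
    rfl
  · rw [if_neg hcr, if_neg]
    rintro ⟨x, hx, hx'⟩
    exact hcr (Z.inter_edge_strand hm hodd hmK hh hi hj b hx hx').1

theorem crossingSign_E_strand (Z : IsZigzag K s c d h) (hm : 2 * m * (d * s * c) = 1)
    (hmK : m ≤ K) (hh : d * c < h - 1 / 2) {i j : Fin (K + 3)}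
    (hi : (i : ℕ) = K + 1) (hj : (j : ℕ) ≠ K + 1) (hov : ¬ covers i j) (b : Bool) :
    (zigzagDiagram K s c d h covers).crossingSign i (j, b) =
      if K ≤ (j : ℕ) ∧ b = true then lineSlope K j else 0 := by
  rw [RibbonDiagram.crossingSign, Z.dir_eq, Z.dir_eq]
  dsimp only
  by_cases hcr : K ≤ (j : ℕ) ∧ b = true
  · obtain ⟨h1, rfl⟩ := hcr
    have h2 := Z.mem_open_E_strand (covers := covers) hm hmK hi (j := j) (by omega)
    rw [if_pos ⟨_, openSegment_subset_segment ℝ _ _ h2.1, openSegment_subset_segment ℝ _ _ h2.2⟩,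
      if_neg (show ¬ (zigzagDiagram K s c d h covers).isOver i j from hov),
      if_pos ⟨h1, rfl⟩, zigzagDir_eq hj, zigzagDir, if_pos hi, planeCross_slope_right,
      sign_slope_mul (lineSlope_cases K j) Z.c_pos]
  · rw [if_neg hcr, if_neg]
    rintro ⟨x, hx, hx'⟩
    have := Z.inter_E_strand hm hh hi hj hx hx'
    exact hcr ⟨this.1, this.2.1⟩

theorem crossingSign_edge_E (Z : IsZigzag K s c d h) (hm : 2 * m * (d * s * c) = 1)
    (hmK : m ≤ K) (hh : d * c < h - 1 / 2) {i j : Fin (K + 3)}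
    (hi : (i : ℕ) ≠ K + 1) (hj : (j : ℕ) = K + 1) (hov : covers i j) (b : Bool) :
    (zigzagDiagram K s c d h covers).crossingSign i (j, b) =
      if K ≤ (i : ℕ) ∧ b = true then lineSlope K i else 0 := by
  rw [RibbonDiagram.crossingSign, Z.dir_eq, Z.dir_eq]
  dsimp only
  by_cases hcr : K ≤ (i : ℕ) ∧ b = true
  · obtain ⟨h1, rfl⟩ := hcr
    have h2 := Z.mem_open_edge_strand_E (covers := covers) hm hmK hh (i := i) (by omega) hj
    rw [if_pos ⟨_, openSegment_subset_segment ℝ _ _ h2.1, openSegment_subset_segment ℝ _ _ h2.2⟩,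
      if_pos (show (zigzagDiagram K s c d h covers).isOver i j from hov),
      if_pos ⟨h1, rfl⟩, zigzagDir_eq hi, zigzagDir, if_pos hj, planeCross_slope_right,
      sign_slope_mul (lineSlope_cases K i) Z.c_pos]
  · rw [if_neg hcr, if_neg]
    rintro ⟨x, hx, hx'⟩
    have := Z.inter_edge_strand_E hm hh hi hj hx hx'
    exact hcr ⟨this.1, this.2.1⟩

end IsZigzag

theorem mobiusLevel_E_lt {m n : ℕ} {i j : Fin (2 * m + 2 * n + 3)}
    (hi : (i : ℕ) = 2 * m + 2 * n + 1) (hj : (j : ℕ) ≠ 2 * m + 2 * n + 1) (hm : 0 < m) :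
    mobiusLevel m n i < mobiusLevel m n j := by
  have := j.2
  rw [mobiusLevel_E hi]
  simp only [mobiusLevel]
  split_ifs <;> omega

/-- The edge EA is crossed only by the rising edge K and the falling edge K + 2. It lies below both,
so their signs are opposite. -/
theorem lineSlope_eq_horizontalContribution {K : ℕ} (hK : Even K) {j : Fin (K + 3)}
    (hj : (j : ℕ) ≠ K + 1) :
    (if K ≤ (j : ℕ) then lineSlope K j else 0) = horizontalContribution K (position j) := by
  have := j.2
  rw [horizontalContribution, position_eq]
  rcases Nat.lt_trichotomy j K with h | h | h
  · rw [if_neg (by omega), if_neg (show (j : ℕ) ≠ K + 2 by omega), if_neg (by omega),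
      if_neg (by omega), sub_zero]
  · rw [h, if_pos le_rfl, lineSlope_K hK, if_neg (show K ≠ K + 2 by omega), if_pos rfl,
      if_neg (by omega), sub_zero]
  · have h : (j : ℕ) = K + 2 := by omega
    rw [h, if_pos (by omega), lineSlope_A, if_pos rfl, if_neg (by omega), if_pos rfl, zero_sub]

open Classical in
theorem sum_crossingSign {m n : ℕ} {s c d h : ℝ} (Z : IsZigzag (2 * m + 2 * n) s c d h)
    (hm : 2 * m * (d * s * c) = 1) (hodd : Odd m) (hh : d * c < h - 1 / 2)
    (i j : Fin (2 * m + 2 * n + 3)) :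
    ∑ b : Bool, (zigzagDiagram (2 * m + 2 * n) s c d h
      (fun i j => mobiusLevel m n j < mobiusLevel m n i)).crossingSign i (j, b) =
      pairContribution (2 * m + 2 * n) m (position i) (position j) +
        pairContribution (2 * m + 2 * n) m (position j) (position i) +
        (if position i = 2 * m + 2 * n + 2 then
          horizontalContribution (2 * m + 2 * n) (position j) else 0) +
        (if position j = 2 * m + 2 * n + 2 then
          horizontalContribution (2 * m + 2 * n) (position i) else 0) := by
  have hm0 : 0 < m := hodd.pos
  have hmK : m ≤ 2 * m + 2 * n := by omega
  have hi3 := i.2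
  have hj3 := j.2
  have pi := position_eq i
  have pj := position_eq j
  rw [Fintype.sum_bool]
  by_cases hi : (i : ℕ) = 2 * m + 2 * n + 1
  · rw [if_neg (by omega)] at pi
    have hp : ∀ q, pairContribution (2 * m + 2 * n) m (position i) q = 0 := fun q => by
      rw [pairContribution, if_neg (by omega)]
    have hq : ∀ q, pairContribution (2 * m + 2 * n) m q (position i) = 0 := fun q => by
      rw [pairContribution, if_neg (by omega)]
    have hE : horizontalContribution (2 * m + 2 * n) (position i) = 0 := by
      rw [horizontalContribution, if_neg (by omega), if_neg (by omega), sub_zero]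
    rw [hp, hq, if_pos (by omega), hE]
    by_cases hj : (j : ℕ) = 2 * m + 2 * n + 1
    · have hij : i = j := Fin.ext (hi.trans hj.symm)
      subst hij
      have hz : ∀ b, (zigzagDiagram (2 * m + 2 * n) s c d h
          (fun i j => mobiusLevel m n j < mobiusLevel m n i)).crossingSign i (i, b) = 0 := fun b => by
        rw [RibbonDiagram.crossingSign, if_neg]
        rintro ⟨x, hx⟩
        exact Z.not_inter_E_E hi hi b hx
      rw [hz, hz, hE]
      simp
    · have hov : ¬ mobiusLevel m n j < mobiusLevel m n i := (mobiusLevel_E_lt hi hj hm0).not_gt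
      rw [Z.crossingSign_E_strand hm hmK hh hi hj hov, Z.crossingSign_E_strand hm hmK hh hi hj hov,
        ← lineSlope_eq_horizontalContribution Z.even hj]
      simp
  · by_cases hj : (j : ℕ) = 2 * m + 2 * n + 1
    · rw [if_neg (by omega)] at pj
      have hpi : position i ≠ 2 * m + 2 * n + 2 := by
        rw [pi]
        split_ifs <;> omega
      have hov : mobiusLevel m n j < mobiusLevel m n i := mobiusLevel_E_lt hj hi hm0
      have hp : pairContribution (2 * m + 2 * n) m (position i) (position j) = 0 := by
        rw [pairContribution, if_neg (by omega)]
      have hq : pairContribution (2 * m + 2 * n) m (position j) (position i) = 0 := by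
        rw [pairContribution, if_neg (by omega)]
      rw [Z.crossingSign_edge_E hm hmK hh hi hj hov, Z.crossingSign_edge_E hm hmK hh hi hj hov,
        ← lineSlope_eq_horizontalContribution Z.even hi, hp, hq, if_neg hpi,
        if_pos (show position j = _ by omega)]
      simp
    · have hpi : position i < 2 * m + 2 * n + 2 := by
        rw [pi]
        split_ifs <;> omega
      have hpj : position j < 2 * m + 2 * n + 2 := by
        rw [pj]
        split_ifs <;> omega
      rw [Z.crossingSign_eq hm hodd hmK hh hi hj, Z.crossingSign_eq hm hodd hmK hh hi hj,
        if_neg hpi.ne, if_neg hpj.ne, add_zero, add_zero,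
        ← sum_crosses hodd hpi hpj (lineSlope_eq_position hi) (lineSlope_eq_position hj)
          (lineBase_eq_position hi) (lineBase_eq_position hj), ← mobiusLevel_eq_position hi,
        ← mobiusLevel_eq_position hj]
      simp only [Crosses, sideInt, if_true, Bool.false_eq_true, if_false]
      congr!

theorem hasRibbonLinkingNumber {m n : ℕ} {s c d h : ℝ} (Z : IsZigzag (2 * m + 2 * n) s c d h)
    (hm : 2 * m * (d * s * c) = 1) (hodd : Odd m) (hh : d * c < h - 1 / 2) :
    (zigzagDiagram (2 * m + 2 * n) s c d h
      (fun i j => mobiusLevel m n j < mobiusLevel m n i)).HasRibbonLinkingNumber (2 * n + 1) := by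
  refine ⟨fun i p _ x hx => Z.crossings_transverse hm hodd (by omega) hh i p hx.1 hx.2, ?_⟩
  rw [RibbonDiagram.boundaryComponent_eq_univ ⟨m + n + 1, by ring⟩, ← sum_contributions n hodd,
    ← sum_sum_position]
  refine Finset.sum_congr rfl fun i _ => ?_
  rw [Fintype.sum_prod_type]
  exact Finset.sum_congr rfl fun j _ => sum_crossingSign Z hm hodd hh i j

open Classical in
-- Exchanging over and under reverses each sign by antisymmetry of the cross product; an edge is
-- parallel to its own strands, so those terms are zero anyway.
theorem RibbonDiagram.HasRibbonLinkingNumber.mirror {N : ℕ} [NeZero N] {D : RibbonDiagram N}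
    {k : ℤ} (hD : D.HasRibbonLinkingNumber k) (hov : ∀ i j, i ≠ j → (D.isOver i j ↔ ¬ D.isOver j i)) :
    D.mirror.HasRibbonLinkingNumber (-k) := by
  refine ⟨hD.1, ?_⟩
  rw [mul_neg, ← hD.2, ← Finset.sum_neg_distrib]
  refine Finset.sum_congr rfl fun i _ => ?_
  rw [← Finset.sum_neg_distrib]
  refine Finset.sum_congr rfl fun p _ => ?_
  have hanti : ∀ z w : ℂ, planeCross w z = -planeCross z w := fun z w => by
    simp only [planeCross, Complex.mul_im, Complex.conj_re, Complex.conj_im]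
    ring
  have hsign : (SignType.sign (planeCross (D.dir p.1) (D.dir i)) : ℤ) =
      -(SignType.sign (planeCross (D.dir i) (D.dir p.1)) : ℤ) := by
    rw [hanti, Left.sign_neg, SignType.coe_neg]
  have e : D.mirror.crossingSign i p = if (segment ℝ (D.vertex i) (D.vertex (i + 1)) ∩
      segment ℝ (D.strandStart p) (D.strandEnd p)).Nonempty then
    (if D.isOver p.1 i then (SignType.sign (planeCross (D.dir i) (D.dir p.1)) : ℤ)
      else (SignType.sign (planeCross (D.dir p.1) (D.dir i)) : ℤ))
    else 0 := rfl
  rw [e, crossingSign]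
  by_cases hip : i = p.1
  · have h0 : (SignType.sign (planeCross (D.dir i) (D.dir p.1)) : ℤ) = 0 := by
      rw [hip] at hsign ⊢
      omega
    rw [hsign, h0]
    simp
  · have := hov _ _ hip
    rw [hsign]
    by_cases h1 : D.isOver p.1 i
    · have h2 : ¬ D.isOver i p.1 := fun h => this.1 h h1
      simp only [h1, h2, if_true, if_false]
      split_ifs <;> simp
    · have h2 : D.isOver i p.1 := this.2 h1
      simp only [h1, h2, if_true, if_false]
      split_ifs <;> simp

/-- Parameters for which the Möbius band with fold angle `π / 3` has folded ribbonlength `3 √3 + ε`. -/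
theorem exists_parameters (n : ℕ) {ε : ℝ} (hε : 0 < ε) : ∃ (m : ℕ) (d h : ℝ), Odd m ∧ 0 < d ∧
    1 / 2 < h ∧ 2 * m * (d * (1 / 2) * (Real.sqrt 3 / 2)) = 1 ∧
    d * (Real.sqrt 3 / 2) < h - 1 / 2 ∧
    ((2 * m + 2 * n : ℕ) : ℝ) * d * (1 + 1 / 2) + 2 * h * ((1 + 1 / 2) / (Real.sqrt 3 / 2)) =
      3 * Real.sqrt 3 + ε := by
  have h3 : 0 < Real.sqrt 3 := by positivity
  have hsq : Real.sqrt 3 ^ 2 = 3 := Real.sq_sqrt (by norm_num)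
  -- With m = 2r + 1 and d c = 1/m, this choice gives (n+1)/m < ε/(2√3), which is the required
  -- inequality d c < h - 1/2.
  obtain ⟨r, hr⟩ := exists_nat_gt ((n + 1) / (ε / (2 * Real.sqrt 3)))
  have hδ : 0 < ε / (2 * Real.sqrt 3) := by positivity
  have hm : (0 : ℝ) < ((2 * r + 1 : ℕ) : ℝ) := by positivity
  have hmr : (r : ℝ) ≤ ((2 * r + 1 : ℕ) : ℝ) := by
    push_cast
    linarith [Nat.cast_nonneg (α := ℝ) r]
  have hlt : (n + 1) / ((2 * r + 1 : ℕ) : ℝ) < ε / (2 * Real.sqrt 3) := by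
    rw [div_lt_iff₀ hm]
    rw [div_lt_iff₀ hδ] at hr
    nlinarith
  have hsplit : (n + 1) / ((2 * r + 1 : ℕ) : ℝ) = n / ((2 * r + 1 : ℕ) : ℝ) +
      1 / ((2 * r + 1 : ℕ) : ℝ) := add_div _ _ _
  have hpos : 0 < 1 / ((2 * r + 1 : ℕ) : ℝ) := by positivity
  -- Here d solves 2mdsc = 1. The length is then 2√3(1 + n/m) + 2√3 h, and h is the solution for the
  -- total 3√3 + ε.
  refine ⟨2 * r + 1, 2 / (Real.sqrt 3 * ((2 * r + 1 : ℕ) : ℝ)),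
    1 / 2 + ε / (2 * Real.sqrt 3) - n / ((2 * r + 1 : ℕ) : ℝ), ⟨r, rfl⟩, by positivity, by linarith,
    ?_, ?_, ?_⟩
  · field_simp
  · have e : 2 / (Real.sqrt 3 * ((2 * r + 1 : ℕ) : ℝ)) * (Real.sqrt 3 / 2) =
        1 / ((2 * r + 1 : ℕ) : ℝ) := by field_simp
    rw [e]
    linarith
  · rw [Nat.cast_add (2 * (2 * r + 1)), Nat.cast_mul 2 (2 * r + 1)]
    generalize ((2 * r + 1 : ℕ) : ℝ) = m at hm
    push_cast
    field_simp
    rw [hsq]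
    ring

theorem sin_half_pi_div_three : Real.sin (Real.pi / 3 / 2) = 1 / 2 := by
  rw [show Real.pi / 3 / 2 = Real.pi / 6 by ring, Real.sin_pi_div_six]

theorem cos_half_pi_div_three : Real.cos (Real.pi / 3 / 2) = Real.sqrt 3 / 2 := by
  rw [show Real.pi / 3 / 2 = Real.pi / 6 by ring, Real.cos_pi_div_six]

/-! ### The main theorem. -/

theorem mainTheorem1 :
    (∀ k : ℤ, Odd k → ∀ ε : ℝ, 0 < ε →
      ∃ (m n : ℕ) (d h : ℝ) (M : RibbonDiagram (2 * m + 2 * n + 3)),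
        k.natAbs = 2 * n + 1 ∧
        IsEscapeAccordion m (Real.pi / 3) d ∧ 0 < h ∧
        (0 < k → M = mobiusBand m n (Real.pi / 3) d h) ∧
        (k < 0 → M = (mobiusBand m n (Real.pi / 3) d h).mirror) ∧
        M.IsFoldedRibbonKnot ∧ M.IsMobius ∧ M.IsUnknot ∧
        M.HasRibbonLinkingNumber k ∧
        (∀ i, M.foldAngle i = Real.pi / 3) ∧
        M.ribbonlength = 3 * Real.sqrt 3 + ε) ∧
    (∀ n : ℕ, ∀ θ ∈ Set.Ioo 0 Real.pi, IsGLB (constructionLengths n θ) (limitRibbonlength θ)) ∧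
    limitRibbonlength (Real.pi / 3) = 3 * Real.sqrt 3 ∧
    (∀ θ ∈ Set.Ioo 0 Real.pi, θ ≠ Real.pi / 3 →
      limitRibbonlength (Real.pi / 3) < limitRibbonlength θ) := by
  refine ⟨fun k hk ε hε => ?_, fun n θ hθ => isGLB_constructionLengths n hθ,
    limitRibbonlength_pi_div_three, fun θ hθ hne => limitRibbonlength_lt hθ hne⟩
  obtain ⟨n, hn⟩ := Int.natAbs_odd.2 hk
  obtain ⟨m, d, h, hodd, hd, hh, hm, hdh, hlen⟩ := exists_parameters n hε
  have hθ : Real.pi / 3 ∈ Set.Ioo 0 Real.pi := ⟨by positivity, by linarith [Real.pi_pos]⟩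
  have hm0 : 0 < m := hodd.pos
  have Z := isZigzag_of_mem n hθ hm0 hd (show 0 < h by linarith)
  have ha : IsEscapeAccordion m (Real.pi / 3) d := by
    refine ⟨hm0, hd, ?_⟩
    rw [sin_half_pi_div_three, cos_half_pi_div_three]
    linarith
  have hF := isFoldedRibbonKnot_of_isEscapeAccordion (n := n) hθ ha hh
  have hN : Odd (2 * m + 2 * n + 3) := ⟨m + n + 1, by ring⟩
  have hdh' : d * Real.cos (Real.pi / 3 / 2) < h - 1 / 2 := by
    rwa [cos_half_pi_div_three]
  have hL : (mobiusBand m n (Real.pi / 3) d h).HasRibbonLinkingNumber (2 * n + 1) := by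
    rw [mobiusBand_eq]
    refine hasRibbonLinkingNumber Z ?_ hodd hdh'
    rwa [sin_half_pi_div_three, cos_half_pi_div_three]
  have hA : ∀ i, (mobiusBand m n (Real.pi / 3) d h).foldAngle i = Real.pi / 3 := by
    rw [mobiusBand_eq]
    exact Z.foldAngle_eq sin_half_pi_div_three
  have hR : (mobiusBand m n (Real.pi / 3) d h).ribbonlength = 3 * Real.sqrt 3 + ε := by
    rw [mobiusBand_eq, Z.ribbonlength_eq, sin_half_pi_div_three, cos_half_pi_div_three]
    exact hlen
  rcases lt_or_gt_of_ne (show k ≠ 0 by rintro rfl; simp at hk) with hneg | hpos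
  · refine ⟨m, n, d, h, (mobiusBand m n (Real.pi / 3) d h).mirror, hn, ha, by linarith,
      fun h => absurd h hneg.not_gt, fun _ => rfl, hF.mirror, RibbonDiagram.isMobius_of_odd _ hN, ?_,
      ?_, hA, hR⟩
    · rw [mirror_mobiusBand_eq]
      exact Z.isUnknot (by linarith)
    · have e : k = -(2 * n + 1) := by omega
      rw [e]
      refine hL.mirror fun i j hij => ?_
      have := (mobiusLevel_injective (n := n) hm0).ne hij
      change mobiusLevel m n j < mobiusLevel m n i ↔ ¬ mobiusLevel m n i < mobiusLevel m n j
      omega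
  · refine ⟨m, n, d, h, mobiusBand m n (Real.pi / 3) d h, hn, ha, by linarith, fun _ => rfl,
      fun h => absurd h hpos.not_gt, hF, RibbonDiagram.isMobius_of_odd _ hN, ?_, ?_, hA, hR⟩
    · rw [mobiusBand_eq]
      exact Z.isUnknot (by linarith)
    · have e : k = 2 * n + 1 := by omega
      rw [e]
      exact hL

end
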